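/- Let $\mathcal V$ be a monoidal category which has all small colimits and whose tensor product preserves small colimits in each variable. A simplicial groupoid is a functor $X\colon\Delta^{\mathrm{op}}\to\mathrm{Grpd}$ to the category of small groupoids, and morphisms of simplicial groupoids are natural transformations. For $n\ge 0$ and a subset $S\subseteq[n]$ write $X_S$ for the value of $X$ on the ordinal $S$. Call $X$ *2-Segal* if 1. for all $0\le i<j\le n$ the square with corners $X_{[n]}$, $X_{\{i,\dots,j\}}$, $X_{\{0,\dots,i,j,\dots,n\}}$, $X_{\{i,j\}}$ (restriction maps) is a 2-pullback of groupoids, and 2. (unitality) for all $0\le i\le n$ the square formed by the degeneracy $s_i\colon X_{[n]}\to X_{[n+1]}$, the vertex map $X_{[n]}\to X_{\{i\}}=X_{[0]}$, the edge map $X_{[n+1]}\to X_{\{i,i+1\}}=X_{[1]}$ and $s_0\colon X_{[0]}\to X_{[1]}$ is a 2-pullback of groupoids. Then the functor categories $[-,\mathcal V]$ induce a functor $$\mathrm{Hall}_{\mathcal V}\colon\{\text{2-Segal simplicial groupoids}\}^{\mathrm{op}}\longrightarrow\{\text{monoidal categories, lax monoidal functors}\}$$ with the following properties. * For every 2-Segal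 simplicial groupoid $X$, $\mathrm{Hall}_{\mathcal V}(X)$ is a monoidal structure on the functor category $[X_{[1]},\mathcal V]$, with tensor product and unit $$F\otimes G=(d_1)_!\bigl(d_2^*F\otimes d_0^*G\bigr),\qquad \mathbb 1=(s_0)_!(\mathrm{const}_{\mathbb 1_{\mathcal V}}),$$ where $(-)_!$ is left Kan extension, along $d_1\colon X_{[2]}\to X_{[1]}$ and $s_0\colon X_{[0]}\to X_{[1]}$ respectively. Let $\eta_t\colon F(d_2t)\otimes G(d_0t)\to(F\otimes G)(d_1t)$ for $t\in X_{[2]}$ and $\varepsilon_z\colon\mathbb 1_{\mathcal V}\to\mathbb 1(s_0z)$ for $z\in X_{[0]}$ be the universal transformations. The tensor product of morphisms makes $\eta$ natural in $F$ and $G$. The associator is induced from that of $\mathcal V$: for all $s\in X_{[3]}$, with edges $s_{ij}$, the two maps obtained by applying $\eta$ twice on the faces $012,023$ and $123,013$ of $s$ respectively, from $(F(s_{01})\otimes G(s_{12}))\otimes K(s_{23})$ to $((F\otimes G)\otimes K)(s_{03})$ and from $F(s_{01})\otimes (G(s_{12})\otimes K(s_{23}))$ to $(F\otimes (G\otimes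 K))(s_{03})$, correspond to each other under the associators of $\mathcal V$ and of $\mathrm{Hall}_{\mathcal V}(X)$. The unitors are likewise induced from those of $\mathcal V$: for all $x\in X_{[1]}$, applying $\varepsilon$ at a vertex of $x$, then $\eta$ at the corresponding degenerate triangle on $x$, and then the unitor of $\mathrm{Hall}_{\mathcal V}(X)$ gives the unitor of $\mathcal V$ at $F(x)$. * For every morphism $f\colon X\to Y$, $\mathrm{Hall}_{\mathcal V}(f)$ is the restriction functor $f_{[1]}^*\colon[Y_{[1]},\mathcal V]\to[X_{[1]},\mathcal V]$ with the lax monoidal structure $f_{[1]}^*F\otimes f_{[1]}^*G\to f_{[1]}^*(F\otimes G)$, $\mathbb 1\to f_{[1]}^*\mathbb 1$ that is compatible with the universal transformations $\eta,\varepsilon$ of $X$ at $t\in X_{[2]}$, $z\in X_{[0]}$ and those of $Y$ at $f_{[2]}(t)$, $f_{[0]}(z)$. -/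

import Mathlib

open CategoryTheory MonoidalCategory Opposite Simplicial

universe w v u v' u'

/-! ### The category of monoidal categories and lax monoidal functors -/

/-- A bundled monoidal category. -/
structure LaxMonCat where
  /-- The underlying type of objects. -/
  carrier : Type u'
  [category : Category.{v'} carrier]
  [monoidal : MonoidalCategory carrier]

namespace LaxMonCat

attribute [instance] category monoidal

/-- Bundle a monoidal category. -/
abbrev of (C : Type u') [Category.{v'} C] [MonoidalCategory C] : LaxMonCat.{v', u'} where
  carrier := C

theorem hom_ext {C : Type u} [Category.{v} C] [MonoidalCategory C] {D : Type u'}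
    [Category.{v'} D] [MonoidalCategory D] (F : C ⥤ D) (h h' : F.LaxMonoidal)
    (hε : h.ε = h'.ε) (hμ : h.μ = h'.μ) :
    ({ toFunctor := F, laxMonoidal := h } : LaxMonoidalFunctor C D) =
      { toFunctor := F, laxMonoidal := h' } := by
  rw [Functor.LaxMonoidal.ext hε hμ]

/-- Morphisms are lax monoidal functors, with the usual composition. -/
instance : Category LaxMonCat.{v', u'} where
  Hom C D := LaxMonoidalFunctor C.carrier D.carrier
  id C := LaxMonoidalFunctor.of (𝟭 C.carrier)
  comp F G := LaxMonoidalFunctor.of (F.toFunctor ⋙ G.toFunctor)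
  id_comp F := by
    obtain ⟨F, hF⟩ := F
    refine hom_ext F _ hF ?_ ?_
    · exact (congrArg (hF.ε ≫ ·) (F.map_id _)).trans (Category.comp_id _)
    · funext A B
      exact (congrArg (hF.μ A B ≫ ·) (F.map_id _)).trans (Category.comp_id _)
  comp_id F := by
    obtain ⟨F, hF⟩ := F
    refine hom_ext F _ hF ?_ ?_
    · exact Category.id_comp _
    · funext A B
      exact Category.id_comp _
  assoc F G H := by
    refine hom_ext (F.toFunctor ⋙ G.toFunctor ⋙ H.toFunctor) _ _ ?_ ?_
    · change Functor.LaxMonoidal.ε ((F.toFunctor ⋙ G.toFunctor) ⋙ H.toFunctor) =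
        Functor.LaxMonoidal.ε (F.toFunctor ⋙ G.toFunctor ⋙ H.toFunctor)
      simp [Functor.LaxMonoidal.comp_ε]
    · funext A B
      change Functor.LaxMonoidal.μ ((F.toFunctor ⋙ G.toFunctor) ⋙ H.toFunctor) A B =
        Functor.LaxMonoidal.μ (F.toFunctor ⋙ G.toFunctor ⋙ H.toFunctor) A B
      simp [Functor.LaxMonoidal.comp_μ]

end LaxMonCat

/-! ### Simplicial groupoids -/

/-- A simplicial groupoid is a functor from `SimplexCategoryᵒᵖ` to the category of small
groupoids; morphisms are natural transformations. -/
abbrev SimplicialGroupoid := SimplicialObject Grpd.{w, w}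

namespace SimplicialGroupoid

variable (X : SimplicialGroupoid.{w})

/-- The groupoid of `n`-simplices. -/
abbrev simplices (n : ℕ) : Type w := (X.obj (op ⦋n⦌) : Grpd.{w, w})

/-- The functor on simplices induced by a morphism of the simplex category. -/
def pull {m n : ℕ} (φ : ⦋m⦌ ⟶ ⦋n⦌) : X.simplices n ⥤ X.simplices m := X.map φ.op

theorem pull_comp {l m n : ℕ} (ψ : ⦋l⦌ ⟶ ⦋m⦌) (φ : ⦋m⦌ ⟶ ⦋n⦌) :
    X.pull φ ⋙ X.pull ψ = X.pull (ψ ≫ φ) :=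
  (X.map_comp φ.op ψ.op).symm

/-- The functor sending an `n`-simplex to its edge from vertex `i` to vertex `j`. On `X_2`,
the functors `edge 0 1`, `edge 1 2`, `edge 0 2` are the face functors `d_2`, `d_0`, `d_1`;
on `X_0`, the functor `edge 0 0` is the degeneracy functor `s_0`. -/
abbrev edge {n : ℕ} (i j : Fin (n + 1)) (h : i ≤ j := by decide) :
    X.simplices n ⥤ X.simplices 1 :=
  X.pull (SimplexCategory.mkOfLe i j h)

/-- The functor sending an `n`-simplex to its (possibly degenerate) triangle on `i ≤ j ≤ k`. -/
abbrev triangle {n : ℕ} (i j k : Fin (n + 1)) (hij : i ≤ j) (hjk : j ≤ k) :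
    X.simplices n ⥤ X.simplices 2 :=
  X.pull (SimplexCategory.mkOfLeComp i j k hij hjk)

/-- The functor sending an `n`-simplex to its vertex `i`. -/
abbrev vertex {n : ℕ} (i : Fin (n + 1)) : X.simplices n ⥤ X.simplices 0 :=
  X.pull (⦋0⦌.const ⦋n⦌ i)

section

variable {X} {n : ℕ} (i j k : Fin (n + 1)) (hij : i ≤ j) (hjk : j ≤ k) (s : X.simplices n)

theorem edge01_triangle :
    (X.edge 0 1).obj ((X.triangle i j k hij hjk).obj s) = (X.edge i j hij).obj s := by
  refine (Functor.congr_obj (X.pull_comp _ _) s).trans ?_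
  congr 2
  exact SimplexCategory.Hom.ext_one_left _ _

theorem edge12_triangle :
    (X.edge 1 2).obj ((X.triangle i j k hij hjk).obj s) = (X.edge j k hjk).obj s := by
  refine (Functor.congr_obj (X.pull_comp _ _) s).trans ?_
  congr 2
  exact SimplexCategory.Hom.ext_one_left _ _

theorem edge02_triangle :
    (X.edge 0 2).obj ((X.triangle i j k hij hjk).obj s) =
      (X.edge i k (hij.trans hjk)).obj s := by
  refine (Functor.congr_obj (X.pull_comp _ _) s).trans ?_
  congr 2
  exact SimplexCategory.Hom.ext_one_left _ _

theorem edge_vertex :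
    (X.edge 0 0).obj ((X.vertex i).obj s) = (X.edge i i le_rfl).obj s := by
  refine (Functor.congr_obj (X.pull_comp _ _) s).trans ?_
  congr 2
  exact SimplexCategory.Hom.ext_one_left _ _

end

/-- The functor `X_n ⥤ Y_n` underlying a morphism of simplicial groupoids. -/
def mapSimplices {X Y : SimplicialGroupoid.{w}} (f : X ⟶ Y) (n : ℕ) :
    X.simplices n ⥤ Y.simplices n := f.app (op ⦋n⦌)

theorem pull_mapSimplices {X Y : SimplicialGroupoid.{w}} (f : X ⟶ Y) {m n : ℕ}
    (φ : ⦋m⦌ ⟶ ⦋n⦌) (s : X.simplices n) :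
    (Y.pull φ).obj ((mapSimplices f n).obj s) = (mapSimplices f m).obj ((X.pull φ).obj s) :=
  (Functor.congr_obj (f.naturality φ.op) s).symm

/-! ### The 2-Segal conditions -/

/-- A strictly commutative square of categories is a 2-pullback (homotopy pullback) if the
induced functor to the category of triples `(b, c, F b ≅ G c)` is an equivalence. -/
def IsTwoPullback {A B C D : Type w} [Category.{w} A] [Category.{w} B] [Category.{w} C]
    [Category.{w} D] (P : A ⥤ B) (Q : A ⥤ C) (F : B ⥤ D) (G : C ⥤ D) (h : P ⋙ F = Q ⋙ G) :
    Prop :=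
  ((Limits.CategoricalPullback.CatCommSqOver.toFunctorToCategoricalPullback F G A).obj
    { fst := P, snd := Q, iso := eqToIso h }).IsEquivalence

/-- The map `[m] → [a + m + b]`, `k ↦ a + k`, with image `{a, …, a + m}`. -/
def inner (a m b : ℕ) : ⦋m⦌ ⟶ ⦋a + m + b⦌ :=
  SimplexCategory.mkHom
    { toFun := fun k => ⟨a + k, by omega⟩
      monotone' := fun k l (h : (k : ℕ) ≤ l) => by simpa using h }

/-- The map `[a + 1 + b] → [a + m + b]` which is the identity on `{0, …, a}` and
`k ↦ k + m - 1` on `{a + 1, …, a + 1 + b}`. Its image is `{0, …, a, a + m, …, a + m + b}`. -/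
def outer (a m b : ℕ) : ⦋a + 1 + b⦌ ⟶ ⦋a + m + b⦌ :=
  SimplexCategory.mkHom
    { toFun := fun k => ⟨if (k : ℕ) ≤ a then k else k + m - 1, by split_ifs <;> omega⟩
      monotone' := fun k l (h : (k : ℕ) ≤ l) => by
        simp only [Fin.mk_le_mk]
        split_ifs <;> omega }

theorem diag_inner (a m b : ℕ) :
    SimplexCategory.mkOfLe 0 (Fin.last m) (Fin.zero_le _) ≫ inner a m b =
      inner a 1 b ≫ outer a m b := by
  apply SimplexCategory.Hom.ext_one_left
  · apply Fin.ext
    change a + 0 = if a + 0 ≤ a then a + 0 else a + 0 + m - 1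
    simp
  · apply Fin.ext
    change a + m = if a + 1 ≤ a then a + 1 else a + 1 + m - 1
    split_ifs <;> omega

/-- The 2-Segal conditions. With `n = a + m + b`, `i = a`, `j = a + m`, the square is
```
  X_n                  ⟶  X_{i, …, j}
   ↓                          ↓
  X_{0, …, i, j, …, n}  ⟶  X_{i, j}
```
* For `m ≥ 2` these are the squares for the subdivisions of the `(n + 1)`-gon along the
  diagonal from `i` to `j` (`0 ≤ i < j ≤ n`).
* For `m = 1` the vertical maps are identities and the condition is void.
* For `m = 0` this is the unitality square
  `X_n ⟶ X_0`, `X_{n+1} ⟶ X_1` with vertical maps `s_i` and `s_0`. -/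
def IsTwoSegal : Prop :=
  ∀ a m b : ℕ,
    IsTwoPullback (X.pull (inner a m b)) (X.pull (outer a m b))
      (X.edge 0 (Fin.last m) (Fin.zero_le _)) (X.pull (inner a 1 b))
      (by rw [edge, pull_comp, pull_comp, diag_inner])

end SimplicialGroupoid

/-- The category of 2-Segal simplicial groupoids (a full subcategory of that of simplicial
groupoids). -/
abbrev TwoSegalGroupoid :=
  ObjectProperty.FullSubcategory (C := SimplicialGroupoid.{w}) SimplicialGroupoid.IsTwoSegal

/-! ### Hall convolution on functor categories -/

section Hall

variable (V : Type u) [Category.{v} V]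

/-- The functor category `[X_1, V]`. (A type synonym, because the functor category already
carries the pointwise monoidal structure as an instance, which is not the one of interest.) -/
def HallCat (X : SimplicialGroupoid.{w}) : Type (max w v u) := X.simplices 1 ⥤ V

instance (X : SimplicialGroupoid.{w}) : Category.{max w v} (HallCat V X) :=
  inferInstanceAs (Category (X.simplices 1 ⥤ V))

namespace HallCat

variable {V} {X Y : SimplicialGroupoid.{w}}

/-- The identity, regarded as a functor from the synonym to the functor category. -/
def und : HallCat V X ⥤ (X.simplices 1 ⥤ V) := 𝟭 _

variable (V) in
/-- Restriction (precomposition) along the functor `f_1 : X_1 ⥤ Y_1`. -/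
def restrict (f : X ⟶ Y) : HallCat V Y ⥤ HallCat V X :=
  (Functor.whiskeringLeft _ _ V).obj (SimplicialGroupoid.mapSimplices f 1)

end HallCat

open SimplicialGroupoid HallCat

variable [MonoidalCategory V]

/-- Data exhibiting the tensor product of a monoidal structure on `[X_1, V]` as
`F ⊗ G = (d_1)_! (d_2^* F ⊗ d_0^* G)` and its unit as `(s_0)_! 1`, where `(-)_!` is left Kan
extension. -/
structure HallConvolutionData (X : SimplicialGroupoid.{w}) [MonoidalCategory (HallCat V X)] where
  /-- The universal transformation
  `F (d_2 t) ⊗ G (d_0 t) ⟶ (F ⊗ G) (d_1 t)`, for `t` in `X_2`. -/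
  mul (F G : HallCat V X) :
    (X.edge (n := 2) 0 1 ⋙ und.obj F) ⊗ (X.edge (n := 2) 1 2 ⋙ und.obj G) ⟶
      X.edge (n := 2) 0 2 ⋙ und.obj (F ⊗ G)
  mul_isLeftKanExtension (F G : HallCat V X) :
    (und.obj (F ⊗ G)).IsLeftKanExtension (mul F G)
  /-- The universal transformation `1 ⟶ 𝟙 (s_0 z)`, for `z` in `X_0`. -/
  one : (Functor.const (X.simplices 0)).obj (𝟙_ V) ⟶
    X.edge (n := 0) 0 0 ⋙ und.obj (𝟙_ (HallCat V X))
  one_isLeftKanExtension : (und.obj (𝟙_ (HallCat V X))).IsLeftKanExtension one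

namespace HallConvolutionData

variable {V} {X : SimplicialGroupoid.{w}} [MonoidalCategory (HallCat V X)]
  (S : HallConvolutionData V X)

/-- The map `F (s_ij) ⊗ G (s_jk) ⟶ (F ⊗ G) (s_ik)` for an `n`-simplex `s` and `i ≤ j ≤ k`: the
universal map at the triangle `s_ijk`. -/
def mulAt (F G : HallCat V X) {n : ℕ} (s : X.simplices n) (i j k : Fin (n + 1))
    (hij : i ≤ j := by decide) (hjk : j ≤ k := by decide) :
    (und.obj F).obj ((X.edge i j hij).obj s) ⊗ (und.obj G).obj ((X.edge j k hjk).obj s) ⟶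
      (und.obj (F ⊗ G)).obj ((X.edge i k (hij.trans hjk)).obj s) :=
  ((und.obj F).map (eqToHom (edge01_triangle i j k hij hjk s).symm) ⊗ₘ
      (und.obj G).map (eqToHom (edge12_triangle i j k hij hjk s).symm)) ≫
    (S.mul F G).app ((X.triangle i j k hij hjk).obj s) ≫
      (und.obj (F ⊗ G)).map (eqToHom (edge02_triangle i j k hij hjk s))

/-- The map `1 ⟶ 𝟙 (s_ii)` for an `n`-simplex `s` and a vertex `i` of it. -/
def oneAt {n : ℕ} (s : X.simplices n) (i : Fin (n + 1)) :
    𝟙_ V ⟶ (und.obj (𝟙_ (HallCat V X))).obj ((X.edge i i le_rfl).obj s) :=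
  S.one.app ((X.vertex i).obj s) ≫
    (und.obj (𝟙_ (HallCat V X))).map (eqToHom (edge_vertex i s))

end HallConvolutionData

/-- A monoidal structure on `[X_1, V]` *is the Hall monoidal structure* if its tensor product and
unit are the ones above, and its action on morphisms, its associator and its unitors are the ones
induced from `V`. By the universal property of Kan extensions and the 2-Segal conditions these
equations determine them. -/
structure HallConvolution (X : SimplicialGroupoid.{w}) [MonoidalCategory (HallCat V X)] extends
    HallConvolutionData V X where
  mul_natural {F F' G G' : HallCat V X} (α : F ⟶ F') (β : G ⟶ G') (t : X.simplices 2) :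
    ((und.map α).app ((X.edge 0 1).obj t) ⊗ₘ (und.map β).app ((X.edge 1 2).obj t)) ≫
        (mul F' G').app t =
      (mul F G).app t ≫ (und.map (α ⊗ₘ β)).app ((X.edge 0 2).obj t)
  associator (F G K : HallCat V X) (s : X.simplices 3) :
    toHallConvolutionData.mulAt F G s 0 1 2 ▷ (und.obj K).obj ((X.edge 2 3).obj s) ≫
        toHallConvolutionData.mulAt (F ⊗ G) K s 0 2 3 ≫
          (und.map (α_ F G K).hom).app ((X.edge 0 3).obj s) =
      (α_ _ _ _).hom ≫
        (und.obj F).obj ((X.edge 0 1).obj s) ◁ toHallConvolutionData.mulAt G K s 1 2 3 ≫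
          toHallConvolutionData.mulAt F (G ⊗ K) s 0 1 3
  leftUnitor (F : HallCat V X) (x : X.simplices 1) :
    toHallConvolutionData.oneAt x 0 ▷ (und.obj F).obj ((X.edge 0 1).obj x) ≫
        toHallConvolutionData.mulAt (𝟙_ (HallCat V X)) F x 0 0 1 ≫
          (und.map (λ_ F).hom).app ((X.edge 0 1).obj x) =
      (λ_ _).hom
  rightUnitor (F : HallCat V X) (x : X.simplices 1) :
    (und.obj F).obj ((X.edge 0 1).obj x) ◁ toHallConvolutionData.oneAt x 1 ≫
        toHallConvolutionData.mulAt F (𝟙_ (HallCat V X)) x 0 1 1 ≫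
          (und.map (ρ_ F).hom).app ((X.edge 0 1).obj x) =
      (ρ_ _).hom

variable {V}

/-- For a morphism `f : X ⟶ Y`, the lax structure `f^* F ⊗ f^* G ⟶ f^* (F ⊗ G)`, `1 ⟶ f^* 1` on the
restriction functor `f^* : [Y_1, V] ⥤ [X_1, V]` *is the canonical one* if it is compatible with
the universal transformations of `X` and `Y`. -/
structure IsHallRestriction {X Y : SimplicialGroupoid.{w}}
    [MonoidalCategory (HallCat V X)] [MonoidalCategory (HallCat V Y)]
    (S : HallConvolution V X) (T : HallConvolution V Y) (f : X ⟶ Y)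
    [(restrict V f).LaxMonoidal] : Prop where
  mul_comp_μ (F G : HallCat V Y) (t : X.simplices 2) :
    (S.mul ((restrict V f).obj F) ((restrict V f).obj G)).app t ≫
        (und.map (Functor.LaxMonoidal.μ (restrict V f) F G)).app ((X.edge 0 2).obj t) =
      ((und.obj F).map (eqToHom (pull_mapSimplices f _ t).symm) ⊗ₘ
          (und.obj G).map (eqToHom (pull_mapSimplices f _ t).symm)) ≫
        (T.mul F G).app ((mapSimplices f 2).obj t) ≫
          (und.obj (F ⊗ G)).map (eqToHom (pull_mapSimplices f _ t))
  one_comp_ε (z : X.simplices 0) :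
    S.one.app z ≫
        (und.map (Functor.LaxMonoidal.ε (restrict V f))).app ((X.edge 0 0).obj z) =
      T.one.app ((mapSimplices f 0).obj z) ≫
        (und.obj (𝟙_ (HallCat V Y))).map (eqToHom (pull_mapSimplices f _ z))

end Hall

/-!
# The Hall monoidal category of a 2-Segal simplicial groupoid

Everything is reduced to universal properties of left Kan extensions.

*Iterated products are Kan extensions.* A 2-pullback square of groupoids is exact in the sense of
Guitart (`IsTwoPullback.guitartExact`), hence left Kan extensions satisfy base change along it.
Since the tensor product of `V` preserves colimits and since the maps of a groupoid are invertible,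
left Kan extensions also satisfy the projection formula `c_! P ⊗ H = c_! (P ⊗ c^* H)`
(`tensorRightIsPointwise`, `tensorLeftIsPointwise`). Together with the composition of Kan extensions
this gives `IsTwoPullback.isLeftKanExtension_tensor_right` and its mirror image. Applied to the
2-Segal squares they show that `(F ⊗ G) ⊗ K` and `F ⊗ (G ⊗ K)` are the left Kan extensions, along
the long edge of tetrahedra, of the two bracketings of `F (s_01) ⊗ G (s_12) ⊗ K (s_23)` in `V`; that
`𝟙 ⊗ F` and `F ⊗ 𝟙` are left Kan extensions of `1 ⊗ F` and `F ⊗ 1` along the identity of `X_1`; and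
that `((F ⊗ G) ⊗ K) ⊗ M` and `(F ⊗ 𝟙) ⊗ G` are left Kan extensions from `X_4` and `X_2`.

*The monoidal structure.* By uniqueness of Kan extensions, the associator and the unitors of `V`
induce `convAssociator`, `convLeftUnitor` and `convRightUnitor`. A map out of a Kan extension is
determined by its composite with the universal map, so the naturality of these isomorphisms, the
pentagon and the triangle follow from those of `V`, evaluated at the faces of a simplex
(`conv_pentagon`, `conv_triangle`).

*Functoriality.* For `f : X ⟶ Y`, the universal maps of `Y` at the simplices in the image of `f`
induce the lax structure `convRestrict`, `convUnitRestrict` on restriction along `f_1`. Its axioms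
and its compatibility with composition are again tested on universal maps.

The edges of a face of a simplex are equal to edges of the simplex, but not by definition. The
universal maps are therefore also considered for triangles whose edges are merely *equal to* given
ones (`convMulAux`, `convOneAux`). Statements about these hold for variable simplices and edges and
are proved by substituting the equalities.
-/

/-! ### Base change and projection formula for left Kan extensions between groupoids -/

namespace SimplicialGroupoid

section GuitartExact

variable {A B C D : Type w} [Groupoid.{w} A] [Groupoid.{w} B] [Groupoid.{w} C] [Groupoid.{w} D]
  {b : A ⥤ B} {c : A ⥤ C} {p : B ⥤ D} {q : C ⥤ D} {h : b ⋙ p = c ⋙ q}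

/-- A 2-pullback square of groupoids is exact: each category of factorizations of a map
`g : p x ⟶ q y` through the square is inhabited because the comparison functor to the 2-pullback is
essentially surjective, and any two of its objects are connected by a map because that functor is
full. -/
theorem IsTwoPullback.guitartExact (hpb : IsTwoPullback b c p q h) :
    (TwoSquare.mk b c p q (eqToHom h)).GuitartExact := by
  rw [TwoSquare.guitartExact_iff_isConnected_rightwards]
  intro x y g
  have : ((Limits.CategoricalPullback.CatCommSqOver.toFunctorToCategoricalPullback p q A).obj
    { fst := b, snd := c, iso := eqToIso h }).IsEquivalence := hpb
  set Φ := (Limits.CategoricalPullback.CatCommSqOver.toFunctorToCategoricalPullback p q A).obj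
    { fst := b, snd := c, iso := eqToIso h }
  let z : Limits.CategoricalPullback p q := ⟨x, y, asIso g⟩
  let e := Φ.objObjPreimageIso z
  have : Nonempty (TwoSquare.StructuredArrowRightwards (TwoSquare.mk b c p q (eqToHom h)) g) := by
    let z₀ : A := Φ.objPreimage z
    let φ : x ⟶ b.obj z₀ := e.inv.fst
    let ψ : b.obj z₀ ⟶ x := e.hom.fst
    let κ : c.obj z₀ ⟶ y := e.hom.snd
    have h₁ : p.map ψ ≫ g = (eqToHom h).app z₀ ≫ q.map κ := e.hom.w
    have h₂ : φ ≫ ψ = 𝟙 x := congrArg (·.fst) e.inv_hom_id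
    refine ⟨TwoSquare.StructuredArrowRightwards.mk _ _ z₀ φ κ ?_⟩
    calc p.map φ ≫ (eqToHom h).app z₀ ≫ q.map κ = p.map φ ≫ p.map ψ ≫ g := by rw [h₁]
      _ = g := by rw [← Category.assoc, ← p.map_comp, h₂, p.map_id, Category.id_comp]
  -- The maps of a groupoid being invertible, two factorizations differ by a map of the 2-pullback,
  -- which lifts along the full functor `Φ`.
  have key : ∀ s t : TwoSquare.StructuredArrowRightwards (TwoSquare.mk b c p q (eqToHom h)) g,
      Nonempty (s ⟶ t) := by
    intro s t
    obtain ⟨a, f, k, hk, rfl⟩ := s.mk_surjective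
    obtain ⟨a', f', k', hk', rfl⟩ := t.mk_surjective
    let m : Φ.obj a ⟶ Φ.obj a' :=
      { fst := Groupoid.inv f ≫ f'
        snd := k ≫ Groupoid.inv k'
        w := by
          change p.map (Groupoid.inv f ≫ f') ≫ (eqToHom h).app a' =
            (eqToHom h).app a ≫ q.map (k ≫ Groupoid.inv k')
          have hk1 : p.map f ≫ (eqToHom h).app a ≫ q.map k = g := hk
          have hk2 : p.map f' ≫ (eqToHom h).app a' ≫ q.map k' = g := hk'
          have h4 := hk2.trans hk1.symm
          rw [← cancel_epi (p.map f), ← cancel_mono (q.map k')]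
          simp only [Functor.map_comp, Category.assoc, Groupoid.inv_eq_inv, Functor.map_inv,
            IsIso.hom_inv_id_assoc, IsIso.inv_hom_id, Category.comp_id]
          exact h4 }
    have hm : Φ.map (Φ.preimage m) = m := Φ.map_preimage m
    have hm1 : b.map (Φ.preimage m) = Groupoid.inv f ≫ f' := congrArg (·.fst) hm
    have hm2 : c.map (Φ.preimage m) = k ≫ Groupoid.inv k' := congrArg (·.snd) hm
    refine ⟨StructuredArrow.homMk (CostructuredArrow.homMk (Φ.preimage m) ?_) ?_⟩
    · change c.map (Φ.preimage m) ≫ k' = k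
      rw [hm2]
      simp
    · ext
      change f ≫ b.map (Φ.preimage m) = f'
      rw [hm1]
      simp
  exact zigzag_isConnected fun s t => Zigzag.of_hom (key s t).some

end GuitartExact

section Tensor

variable {V : Type u} [Category.{v} V] [MonoidalCategory V]

section ProjectionFormula

variable {A C : Type w} [Category.{w} A] [Groupoid.{w} C] {c : A ⥤ C} {P : A ⥤ V} {L : C ⥤ V}

/-- The projection formula: tensoring a pointwise left Kan extension along `c` with a functor `H` on
the target gives a left Kan extension of the tensor product with the restriction of `H`. Since
the target is a groupoid, the diagram at `y` is that of `P`, tensored with the constant `H y`. -/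
noncomputable def tensorRightIsPointwise
    [∀ Z : V, Limits.PreservesColimitsOfSize.{w, w} (tensorRight Z)]
    (η : P ⟶ c ⋙ L) (hη : (Functor.LeftExtension.mk L η).IsPointwiseLeftKanExtension)
    (H : C ⥤ V) :
    (Functor.LeftExtension.mk (L ⊗ H) (F := P ⊗ (c ⋙ H)) (L := c)
      { app := fun a => η.app a ▷ H.obj (c.obj a)
        naturality := fun a a' f => by
          have := η.naturality f
          dsimp at this ⊢
          rw [tensorHom_def'_assoc, tensorHom_def', ← comp_whiskerRight, this, comp_whiskerRight,
            whisker_exchange_assoc] }).IsPointwiseLeftKanExtension := by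
  intro y
  refine (Limits.IsColimit.equivOfNatIsoOfIso
    (NatIso.ofComponents (fun j => whiskerLeftIso (P.obj j.left) (H.mapIso (asIso j.hom)).symm) ?_)
    _ _ ?_)
    (Limits.isColimitOfPreserves (tensorRight (H.obj y)) (hη y))
  · intro j j' f
    have h₁ : c.map f.left ≫ j'.hom = j.hom := CostructuredArrow.w f
    have h₂ : inv j.hom ≫ c.map f.left = inv j'.hom := by
      rw [IsIso.inv_comp_eq, ← h₁]; simp
    change (P.map f.left ▷ H.obj y) ≫ (P.obj j'.left ◁ H.map (inv j'.hom)) =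
      (P.obj j.left ◁ H.map (inv j.hom)) ≫ (P.map f.left ⊗ₘ H.map (c.map f.left))
    rw [← h₂, MonoidalCategory.tensorHom_def, Functor.map_comp, MonoidalCategory.whiskerLeft_comp,
      whisker_exchange_assoc]
  · refine Limits.Cocone.ext (Iso.refl _) ?_
    intro j
    change ((P.obj j.left ◁ H.map j.hom) ≫ ((η.app j.left ≫ L.map j.hom) ▷ H.obj y)) ≫ 𝟙 _ =
      (η.app j.left ▷ H.obj (c.obj j.left)) ≫ (L.map j.hom ⊗ₘ H.map j.hom)
    rw [Category.comp_id, MonoidalCategory.tensorHom_def', comp_whiskerRight,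
      whisker_exchange_assoc]

/-- The mirror image of `tensorRightIsPointwise`. -/
noncomputable def tensorLeftIsPointwise
    [∀ Z : V, Limits.PreservesColimitsOfSize.{w, w} (tensorLeft Z)]
    (η : P ⟶ c ⋙ L) (hη : (Functor.LeftExtension.mk L η).IsPointwiseLeftKanExtension)
    (H : C ⥤ V) :
    (Functor.LeftExtension.mk (H ⊗ L) (F := (c ⋙ H) ⊗ P) (L := c)
      { app := fun a => H.obj (c.obj a) ◁ η.app a
        naturality := fun a a' f => by
          have := η.naturality f
          dsimp at this ⊢
          rw [MonoidalCategory.tensorHom_def_assoc, MonoidalCategory.tensorHom_def,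
            ← MonoidalCategory.whiskerLeft_comp, this, MonoidalCategory.whiskerLeft_comp,
            whisker_exchange_assoc] }).IsPointwiseLeftKanExtension := by
  intro y
  refine (Limits.IsColimit.equivOfNatIsoOfIso
    (NatIso.ofComponents (fun j => whiskerRightIso (H.mapIso (asIso j.hom)).symm (P.obj j.left)) ?_)
    _ _ ?_)
    (Limits.isColimitOfPreserves (tensorLeft (H.obj y)) (hη y))
  · intro j j' f
    have h₁ : c.map f.left ≫ j'.hom = j.hom := CostructuredArrow.w f
    have h₂ : inv j.hom ≫ c.map f.left = inv j'.hom := by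
      rw [IsIso.inv_comp_eq, ← h₁]; simp
    change (H.obj y ◁ P.map f.left) ≫ (H.map (inv j'.hom) ▷ P.obj j'.left) =
      (H.map (inv j.hom) ▷ P.obj j.left) ≫ (H.map (c.map f.left) ⊗ₘ P.map f.left)
    rw [← h₂, MonoidalCategory.tensorHom_def', Functor.map_comp, comp_whiskerRight,
      ← whisker_exchange_assoc]
  · refine Limits.Cocone.ext (Iso.refl _) ?_
    intro j
    change ((H.map j.hom ▷ P.obj j.left) ≫ (H.obj y ◁ (η.app j.left ≫ L.map j.hom))) ≫ 𝟙 _ =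
      (H.obj (c.obj j.left) ◁ η.app j.left) ≫ (H.map j.hom ⊗ₘ L.map j.hom)
    rw [Category.comp_id, MonoidalCategory.tensorHom_def, MonoidalCategory.whiskerLeft_comp,
      ← whisker_exchange_assoc]

end ProjectionFormula

section BaseChange

variable [Limits.HasColimitsOfSize.{w, w} V]

variable {A B C D D' : Type w} [Groupoid.{w} A] [Groupoid.{w} B] [Groupoid.{w} C] [Groupoid.{w} D]
  [Groupoid.{w} D'] {b : A ⥤ B} {c : A ⥤ C} {p : B ⥤ D} {q : C ⥤ D} {h : b ⋙ p = c ⋙ q}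
  {P : B ⥤ V} {L : D ⥤ V} {H : C ⥤ V} {r : C ⥤ D'} {M : D' ⥤ V} {P' H' : A ⥤ V} {r' : A ⥤ D'}

/-- Given a 2-pullback square of groupoids, `L` a left Kan extension of `P` along `p` and `M` a left
Kan extension of `q^* L ⊗ H` along `r`, then `M` is a left Kan extension of `b^* P ⊗ c^* H` along
`c ⋙ r`. The functors `P'`, `H'`, `r'` stand for `b ⋙ P`, `c ⋙ H`, `c ⋙ r`. -/
theorem IsTwoPullback.isLeftKanExtension_tensor_right
    [∀ Z : V, Limits.PreservesColimitsOfSize.{w, w} (tensorRight Z)]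
    (hpb : IsTwoPullback b c p q h)
    (η : P ⟶ p ⋙ L) [L.IsLeftKanExtension η] (μ : (q ⋙ L) ⊗ H ⟶ r ⋙ M) [M.IsLeftKanExtension μ]
    (eP : P' ≅ b ⋙ P) (eH : H' ≅ c ⋙ H) (er : c ⋙ r ≅ r') (θ : P' ⊗ H' ⟶ r' ⋙ M)
    (hθ : ∀ a, θ.app a = ((eP.hom.app a ≫ η.app (b.obj a) ≫ L.map ((eqToHom h).app a)) ⊗ₘ
      eH.hom.app a) ≫ μ.app (c.obj a) ≫ M.map (er.hom.app a)) :
    M.IsLeftKanExtension θ := by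
  have := hpb.guitartExact
  have hη : (Functor.LeftExtension.mk L η).IsPointwiseLeftKanExtension :=
    Functor.isPointwiseLeftKanExtensionOfIsLeftKanExtension _ _
  -- Base change: `q^* L` is a left Kan extension of `b^* P` along `c`. By the projection formula,
  -- `q^* L ⊗ H` is one of `b^* P ⊗ c^* H` along `c`, and Kan extensions compose.
  have h₁ := tensorRightIsPointwise _
    (hη.compTwoSquare (TwoSquare.mk b c p q (eqToHom h))) H
  have h₂ := h₁.isLeftKanExtension
  have h₃ := (@Functor.isLeftKanExtension_iff_postcompose _ _ _ _ _ _ _ _ _ _ _ _ _ h₂ _ r' er μ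
    ((eP.inv ⊗ₘ eH.inv) ≫ θ) ?_).1 ‹_›
  · refine (Functor.isLeftKanExtension_iff_of_iso₂ (L := r') _ θ
      (eP.symm ⊗ᵢ eH.symm) (Iso.refl _) ?_).1 h₃
    simp
  · ext a
    -- The identities are components of the structure maps of `TwoSquare` and of associators.
    have key : ∀ {X X' Y Y' Z Z' T U : V} (i : X' ≅ X) (f : X ⟶ Y) (g : Y ⟶ Y') (j : Z' ≅ Z)
        (m : Y' ⊗ Z ⟶ T) (k : T ⟶ U), ((f ≫ 𝟙 _ ≫ g ≫ 𝟙 _) ▷ Z) ≫ m ≫ 𝟙 _ ≫ k =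
          (i.inv ⊗ₘ j.inv) ≫ ((i.hom ≫ f ≫ g) ⊗ₘ j.hom) ≫ m ≫ k := by
      intros
      simp [MonoidalCategory.tensorHom_comp_tensorHom_assoc]
    exact (key (eP.app a) (η.app (b.obj a)) (L.map ((eqToHom h).app a)) (eH.app a)
      (μ.app (c.obj a)) (M.map (er.hom.app a))).trans (congrArg (_ ≫ ·) (hθ a).symm)

/-- The mirror image of `IsTwoPullback.isLeftKanExtension_tensor_right`. -/
theorem IsTwoPullback.isLeftKanExtension_tensor_left
    [∀ Z : V, Limits.PreservesColimitsOfSize.{w, w} (tensorLeft Z)]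
    (hpb : IsTwoPullback b c p q h)
    (η : P ⟶ p ⋙ L) [L.IsLeftKanExtension η] (μ : H ⊗ (q ⋙ L) ⟶ r ⋙ M) [M.IsLeftKanExtension μ]
    (eP : P' ≅ b ⋙ P) (eH : H' ≅ c ⋙ H) (er : c ⋙ r ≅ r') (θ : H' ⊗ P' ⟶ r' ⋙ M)
    (hθ : ∀ a, θ.app a = (eH.hom.app a ⊗ₘ
      (eP.hom.app a ≫ η.app (b.obj a) ≫ L.map ((eqToHom h).app a))) ≫
        μ.app (c.obj a) ≫ M.map (er.hom.app a)) :
    M.IsLeftKanExtension θ := by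
  have := hpb.guitartExact
  have hη : (Functor.LeftExtension.mk L η).IsPointwiseLeftKanExtension :=
    Functor.isPointwiseLeftKanExtensionOfIsLeftKanExtension _ _
  have h₁ := tensorLeftIsPointwise _
    (hη.compTwoSquare (TwoSquare.mk b c p q (eqToHom h))) H
  have h₂ := h₁.isLeftKanExtension
  have h₃ := (@Functor.isLeftKanExtension_iff_postcompose _ _ _ _ _ _ _ _ _ _ _ _ _ h₂ _ r' er μ
    ((eH.inv ⊗ₘ eP.inv) ≫ θ) ?_).1 ‹_›
  · refine (Functor.isLeftKanExtension_iff_of_iso₂ (L := r') _ θ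
      (eH.symm ⊗ᵢ eP.symm) (Iso.refl _) ?_).1 h₃
    simp
  · ext a
    -- The identities are components of the structure maps of `TwoSquare` and of associators.
    have key : ∀ {X X' Y Y' Z Z' T U : V} (i : X' ≅ X) (f : X ⟶ Y) (g : Y ⟶ Y') (j : Z' ≅ Z)
        (m : Z ⊗ Y' ⟶ T) (k : T ⟶ U), (Z ◁ (f ≫ 𝟙 _ ≫ g ≫ 𝟙 _)) ≫ m ≫ 𝟙 _ ≫ k =
          (j.inv ⊗ₘ i.inv) ≫ (j.hom ⊗ₘ (i.hom ≫ f ≫ g)) ≫ m ≫ k := by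
      intros
      simp [MonoidalCategory.tensorHom_comp_tensorHom_assoc]
    exact (key (eP.app a) (η.app (b.obj a)) (L.map ((eqToHom h).app a)) (eH.app a)
      (μ.app (c.obj a)) (M.map (er.hom.app a))).trans (congrArg (_ ≫ ·) (hθ a).symm)

end BaseChange

end Tensor

/-! ### The convolution product and its universal transformation -/

section Convolution

variable {V : Type u} [Category.{v} V] [MonoidalCategory V] [Limits.HasColimitsOfSize.{w, w} V]
  {X : SimplicialGroupoid.{w}}

/-- The convolution product `(d_1)_! (d_2^* F ⊗ d_0^* G)` on `[X_1, V]`. -/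
noncomputable def conv (F G : X.simplices 1 ⥤ V) : X.simplices 1 ⥤ V :=
  (X.edge (n := 2) 0 2).leftKanExtension
    ((X.edge (n := 2) 0 1 ⋙ F) ⊗ (X.edge (n := 2) 1 2 ⋙ G))

/-- The universal transformation of the convolution product. -/
noncomputable def convMul (F G : X.simplices 1 ⥤ V) :
    (X.edge (n := 2) 0 1 ⋙ F) ⊗ (X.edge (n := 2) 1 2 ⋙ G) ⟶ X.edge (n := 2) 0 2 ⋙ conv F G :=
  Functor.leftKanExtensionUnit _ _

instance (F G : X.simplices 1 ⥤ V) : (conv F G).IsLeftKanExtension (convMul F G) :=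
  inferInstanceAs (Functor.IsLeftKanExtension _ (Functor.leftKanExtensionUnit _ _))

/-- The component at a triangle `t` of the universal transformation of the convolution product. -/
noncomputable def convMulApp (F G : X.simplices 1 ⥤ V) (t : X.simplices 2) :
    F.obj ((X.edge 0 1).obj t) ⊗ G.obj ((X.edge 1 2).obj t) ⟶
      (conv F G).obj ((X.edge 0 2).obj t) :=
  (convMul F G).app t

theorem convMulApp_naturality (F G : X.simplices 1 ⥤ V) {t t' : X.simplices 2} (f : t ⟶ t') :
    (F.map ((X.edge 0 1).map f) ⊗ₘ G.map ((X.edge 1 2).map f)) ≫ convMulApp F G t' =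
      convMulApp F G t ≫ (conv F G).map ((X.edge 0 2).map f) :=
  (convMul F G).naturality f

variable (V X) in
/-- The unit `(s_0)_! 1` of the convolution product. -/
noncomputable def convUnit : X.simplices 1 ⥤ V :=
  (X.edge (n := 0) 0 0).leftKanExtension ((Functor.const (X.simplices 0)).obj (𝟙_ V))

variable (V X) in
/-- The universal transformation of the unit. -/
noncomputable def convOne :
    (Functor.const (X.simplices 0)).obj (𝟙_ V) ⟶ X.edge (n := 0) 0 0 ⋙ convUnit V X :=
  Functor.leftKanExtensionUnit _ _

instance : (convUnit V X).IsLeftKanExtension (convOne V X) :=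
  inferInstanceAs (Functor.IsLeftKanExtension _ (Functor.leftKanExtensionUnit _ _))

variable (V) in
/-- The component at a vertex `p` of the universal transformation of the unit. -/
noncomputable def convOneApp (p : X.simplices 0) :
    𝟙_ V ⟶ (convUnit V X).obj ((X.edge 0 0).obj p) :=
  (convOne V X).app p

theorem convOneApp_naturality {p p' : X.simplices 0} (f : p ⟶ p') :
    convOneApp V p' = convOneApp V p ≫ (convUnit V X).map ((X.edge 0 0).map f) :=
  (Category.id_comp _).symm.trans ((convOne V X).naturality f)

/-- The universal map at a triangle `t` whose edges `01`, `12`, `02` are *equal to* `x`, `y`, `z`.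
Keeping these equalities as variables makes it possible to eliminate them by substitution. -/
noncomputable def convMulAux (F G : X.simplices 1 ⥤ V) (t : X.simplices 2) {x y z : X.simplices 1}
    (hx : (X.edge 0 1).obj t = x) (hy : (X.edge 1 2).obj t = y) (hz : (X.edge 0 2).obj t = z) :
    F.obj x ⊗ G.obj y ⟶ (conv F G).obj z :=
  (F.map (eqToHom hx.symm) ⊗ₘ G.map (eqToHom hy.symm)) ≫
    convMulApp F G t ≫ (conv F G).map (eqToHom hz)

/-- The universal map at a vertex `p` with `s_0 p = x`. -/
noncomputable def convOneAux (p : X.simplices 0) {x : X.simplices 1}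
    (hx : (X.edge 0 0).obj p = x) : 𝟙_ V ⟶ (convUnit V X).obj x :=
  convOneApp V p ≫ (convUnit V X).map (eqToHom hx)

/-- The map `F (s_ij) ⊗ G (s_jk) ⟶ (F ⊗ G) (s_ik)` for an `n`-simplex `s`: the universal map at the
triangle `s_ijk`. -/
noncomputable def convMulAt (F G : X.simplices 1 ⥤ V) {n : ℕ} (s : X.simplices n)
    (i j k : Fin (n + 1)) (hij : i ≤ j := by decide) (hjk : j ≤ k := by decide) :
    F.obj ((X.edge i j hij).obj s) ⊗ G.obj ((X.edge j k hjk).obj s) ⟶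
      (conv F G).obj ((X.edge i k (hij.trans hjk)).obj s) :=
  convMulAux F G ((X.triangle i j k hij hjk).obj s) (edge01_triangle i j k hij hjk s)
    (edge12_triangle i j k hij hjk s) (edge02_triangle i j k hij hjk s)

/-- The map `1 ⟶ 𝟙 (s_ii)` for an `n`-simplex `s` and a vertex `i` of it: the universal map at the
vertex `i`. -/
noncomputable def convOneAt {n : ℕ} (s : X.simplices n) (i : Fin (n + 1)) :
    𝟙_ V ⟶ (convUnit V X).obj ((X.edge i i le_rfl).obj s) :=
  convOneAux ((X.vertex i).obj s) (edge_vertex i s)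

section

variable {n : ℕ} (i j k : Fin (n + 1)) (hij : i ≤ j) (hjk : j ≤ k)

theorem triangle_comp_edge01 : X.triangle i j k hij hjk ⋙ X.edge 0 1 = X.edge i j hij := by
  rw [pull_comp]
  congr 1
  exact SimplexCategory.Hom.ext_one_left _ _

theorem triangle_comp_edge12 : X.triangle i j k hij hjk ⋙ X.edge 1 2 = X.edge j k hjk := by
  rw [pull_comp]
  congr 1
  exact SimplexCategory.Hom.ext_one_left _ _

theorem triangle_comp_edge02 :
    X.triangle i j k hij hjk ⋙ X.edge 0 2 = X.edge i k (hij.trans hjk) := by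
  rw [pull_comp]
  congr 1
  exact SimplexCategory.Hom.ext_one_left _ _

theorem vertex_comp_edge : X.vertex i ⋙ X.edge 0 0 = X.edge i i le_rfl := by
  rw [pull_comp]
  congr 1
  exact SimplexCategory.Hom.ext_one_left _ _

end

theorem convMulAux_naturality (F G : X.simplices 1 ⥤ V) {t t' : X.simplices 2} (f : t ⟶ t')
    {x x' y y' z z' : X.simplices 1}
    {hx : (X.edge 0 1).obj t = x} {hy : (X.edge 1 2).obj t = y} {hz : (X.edge 0 2).obj t = z}
    {hx' : (X.edge 0 1).obj t' = x'} {hy' : (X.edge 1 2).obj t' = y'}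
    {hz' : (X.edge 0 2).obj t' = z'} (a : x ⟶ x') (b : y ⟶ y') (c : z ⟶ z')
    (ha : (X.edge 0 1).map f = eqToHom hx ≫ a ≫ eqToHom hx'.symm)
    (hb : (X.edge 1 2).map f = eqToHom hy ≫ b ≫ eqToHom hy'.symm)
    (hc : (X.edge 0 2).map f = eqToHom hz ≫ c ≫ eqToHom hz'.symm) :
    (F.map a ⊗ₘ G.map b) ≫ convMulAux F G t' hx' hy' hz' =
      convMulAux F G t hx hy hz ≫ (conv F G).map c := by
  subst hx hy hz hx' hy' hz'
  simp only [eqToHom_refl, Category.id_comp, Category.comp_id] at ha hb hc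
  subst ha hb hc
  simp only [convMulAux, eqToHom_refl, CategoryTheory.Functor.map_id, id_tensorHom_id,
    Category.id_comp, Category.comp_id]
  exact convMulApp_naturality F G f

theorem convMulAt_naturality (F G : X.simplices 1 ⥤ V) {n : ℕ} {s s' : X.simplices n} (f : s ⟶ s')
    (i j k : Fin (n + 1)) (hij : i ≤ j) (hjk : j ≤ k) :
    (F.map ((X.edge i j hij).map f) ⊗ₘ G.map ((X.edge j k hjk).map f)) ≫
        convMulAt F G s' i j k hij hjk =
      convMulAt F G s i j k hij hjk ≫ (conv F G).map ((X.edge i k (hij.trans hjk)).map f) :=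
  convMulAux_naturality F G ((X.triangle i j k hij hjk).map f) _ _ _
    (Functor.congr_hom (triangle_comp_edge01 i j k hij hjk) f)
    (Functor.congr_hom (triangle_comp_edge12 i j k hij hjk) f)
    (Functor.congr_hom (triangle_comp_edge02 i j k hij hjk) f)

theorem convOneAux_naturality {p p' : X.simplices 0} (f : p ⟶ p') {x x' : X.simplices 1}
    {hx : (X.edge 0 0).obj p = x} {hx' : (X.edge 0 0).obj p' = x'} (a : x ⟶ x')
    (ha : (X.edge 0 0).map f = eqToHom hx ≫ a ≫ eqToHom hx'.symm) :
    convOneAux (V := V) p' hx' = convOneAux p hx ≫ (convUnit V X).map a := by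
  subst hx hx'
  simp only [eqToHom_refl, Category.id_comp, Category.comp_id] at ha
  subst ha
  simp only [convOneAux, eqToHom_refl, CategoryTheory.Functor.map_id, Category.comp_id]
  exact convOneApp_naturality f

theorem convOneAt_naturality {n : ℕ} {s s' : X.simplices n} (f : s ⟶ s') (i : Fin (n + 1)) :
    convOneAt (V := V) s' i = convOneAt s i ≫ (convUnit V X).map ((X.edge i i le_rfl).map f) :=
  convOneAux_naturality ((X.vertex i).map f) _ (Functor.congr_hom (vertex_comp_edge i) f)

/-- The maps `convMulAt F G s i j k` as a natural transformation in `s`. -/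
noncomputable def convMulNat (F G : X.simplices 1 ⥤ V) {n : ℕ}
    (i j k : Fin (n + 1)) (hij : i ≤ j := by decide) (hjk : j ≤ k := by decide) :
    (X.edge i j hij ⋙ F) ⊗ (X.edge j k hjk ⋙ G) ⟶ X.edge i k (hij.trans hjk) ⋙ conv F G where
  app s := convMulAt F G s i j k hij hjk
  naturality _ _ f := convMulAt_naturality F G f i j k hij hjk

/-- The maps `convOneAt s i` as a natural transformation in `s`. -/
noncomputable def convOneNat {n : ℕ} (i : Fin (n + 1)) :
    (Functor.const (X.simplices n)).obj (𝟙_ V) ⟶ X.edge i i le_rfl ⋙ convUnit V X where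
  app s := convOneAt s i
  naturality _ _ f := (Category.id_comp _).trans (convOneAt_naturality f i)

/-! ### Left Kan extensions over higher simplices -/

/-- Suppose that the `n`-simplices of `X` are the `m`-simplices glued to triangles along
the edge `0 1` of the latter. If `L` is the left Kan extension of `P` along the long edge of
`m`-simplices, then `L ⊗ K` is the left Kan extension of the tensor product of `P` and `K`, both
restricted to `X_n`, along the edge `i k`. The functor `P'` stands for the restriction of `P`, and
`η'` for the map induced by `η`; they are variables so that iterated products can be treated. -/
theorem isLeftKanExtension_convMul_right
    [∀ A : V, Limits.PreservesColimitsOfSize.{w, w} (tensorRight A)]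
    {m n : ℕ} (φ : ⦋m⦌ ⟶ ⦋n⦌) (i j k : Fin (n + 1)) (hij : i ≤ j) (hjk : j ≤ k)
    {h : X.pull φ ⋙ X.edge 0 (Fin.last m) (Fin.zero_le _) =
      X.triangle i j k hij hjk ⋙ X.edge 0 1}
    (hpb : IsTwoPullback (X.pull φ) (X.triangle i j k hij hjk) _ _ h)
    {P : X.simplices m ⥤ V} {L : X.simplices 1 ⥤ V}
    (η : P ⟶ X.edge 0 (Fin.last m) (Fin.zero_le _) ⋙ L) [L.IsLeftKanExtension η]
    {P' : X.simplices n ⥤ V} (η' : P' ⟶ X.edge i j hij ⋙ L) (eP : P' ≅ X.pull φ ⋙ P)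
    (hη' : ∀ s, η'.app s = eP.hom.app s ≫ η.app ((X.pull φ).obj s) ≫
      L.map (eqToHom ((Functor.congr_obj h s).trans (edge01_triangle i j k hij hjk s))))
    (K : X.simplices 1 ⥤ V) :
    (conv L K).IsLeftKanExtension
      ((η' ▷ (X.edge j k hjk ⋙ K)) ≫ convMulNat L K i j k hij hjk) := by
  refine hpb.isLeftKanExtension_tensor_right η (convMul L K) eP
    (Functor.isoWhiskerRight (eqToIso (triangle_comp_edge12 i j k hij hjk).symm) K)
    (eqToIso (triangle_comp_edge02 i j k hij hjk)) _ ?_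
  intro s
  change η'.app s ▷ _ ≫ convMulAt L K s i j k hij hjk = _
  rw [hη', convMulAt, convMulAux, ← tensorHom_id,
    MonoidalCategory.tensorHom_comp_tensorHom_assoc]
  refine congrArg₂ (· ≫ ·) (congrArg₂ (· ⊗ₘ ·) ?_ ?_)
    (congrArg (convMulApp L K _ ≫ ·) (congrArg (conv L K).map ?_))
  · have h₁ := eqToHom_app h s
    rw [Category.assoc, Category.assoc, ← L.map_comp, eqToHom_trans]
    exact congrArg (fun e => _ ≫ _ ≫ L.map e) h₁.symm
  · rw [Category.id_comp]
    exact congrArg K.map (eqToHom_app (triangle_comp_edge12 i j k hij hjk).symm s).symm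
  · exact (eqToHom_app (triangle_comp_edge02 i j k hij hjk) s).symm

/-- The mirror image of `isLeftKanExtension_convMul_right`. -/
theorem isLeftKanExtension_convMul_left
    [∀ A : V, Limits.PreservesColimitsOfSize.{w, w} (tensorLeft A)]
    {m n : ℕ} (φ : ⦋m⦌ ⟶ ⦋n⦌) (i j k : Fin (n + 1)) (hij : i ≤ j) (hjk : j ≤ k)
    {h : X.pull φ ⋙ X.edge 0 (Fin.last m) (Fin.zero_le _) =
      X.triangle i j k hij hjk ⋙ X.edge 1 2}
    (hpb : IsTwoPullback (X.pull φ) (X.triangle i j k hij hjk) _ _ h)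
    {P : X.simplices m ⥤ V} {L : X.simplices 1 ⥤ V}
    (η : P ⟶ X.edge 0 (Fin.last m) (Fin.zero_le _) ⋙ L) [L.IsLeftKanExtension η]
    {P' : X.simplices n ⥤ V} (η' : P' ⟶ X.edge j k hjk ⋙ L) (eP : P' ≅ X.pull φ ⋙ P)
    (hη' : ∀ s, η'.app s = eP.hom.app s ≫ η.app ((X.pull φ).obj s) ≫
      L.map (eqToHom ((Functor.congr_obj h s).trans (edge12_triangle i j k hij hjk s))))
    (K : X.simplices 1 ⥤ V) :
    (conv K L).IsLeftKanExtension
      (((X.edge i j hij ⋙ K) ◁ η') ≫ convMulNat K L i j k hij hjk) := by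
  refine hpb.isLeftKanExtension_tensor_left η (convMul K L) eP
    (Functor.isoWhiskerRight (eqToIso (triangle_comp_edge01 i j k hij hjk).symm) K)
    (eqToIso (triangle_comp_edge02 i j k hij hjk)) _ ?_
  intro s
  change _ ◁ η'.app s ≫ convMulAt K L s i j k hij hjk = _
  rw [hη', convMulAt, convMulAux, ← id_tensorHom,
    MonoidalCategory.tensorHom_comp_tensorHom_assoc]
  refine congrArg₂ (· ≫ ·) (congrArg₂ (· ⊗ₘ ·) ?_ ?_)
    (congrArg (convMulApp K L _ ≫ ·) (congrArg (conv K L).map ?_))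
  · rw [Category.id_comp]
    exact congrArg K.map (eqToHom_app (triangle_comp_edge01 i j k hij hjk).symm s).symm
  · have h₁ := eqToHom_app h s
    rw [Category.assoc, Category.assoc, ← L.map_comp, eqToHom_trans]
    exact congrArg (fun e => _ ≫ _ ≫ L.map e) h₁.symm
  · exact (eqToHom_app (triangle_comp_edge02 i j k hij hjk) s).symm

/-! ### The instances of the 2-Segal conditions in low dimensions -/

/-- The map `⦋3⦌ ⟶ ⦋n⦌` with values `i ≤ j ≤ k ≤ l`. -/
def tetrahedronMap {n : ℕ} (i j k l : Fin (n + 1)) (hij : i ≤ j) (hjk : j ≤ k) (hkl : k ≤ l) :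
    ⦋3⦌ ⟶ ⦋n⦌ :=
  SimplexCategory.mkHom
    { toFun := ![i, j, k, l]
      monotone' := by
        refine Fin.monotone_iff_le_succ.2 fun a => ?_
        fin_cases a
        exacts [hij, hjk, hkl] }

theorem inner_zero_zero_one : inner 0 0 1 = ⦋0⦌.const ⦋1⦌ 0 := by
  ext a; fin_cases a; rfl

theorem outer_zero_zero_one :
    outer 0 0 1 = SimplexCategory.mkOfLeComp (n := 1) 0 0 1 (by decide) (by decide) := by
  ext a; fin_cases a <;> rfl

theorem inner_zero_one_one : inner 0 1 1 = SimplexCategory.mkOfLe (n := 2) 0 1 (by decide) := by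
  ext a; fin_cases a <;> rfl

theorem outer_zero_one_one :
    outer 0 1 1 = SimplexCategory.mkOfLeComp (n := 2) 0 1 2 (by decide) (by decide) := by
  ext a; fin_cases a <;> rfl

theorem inner_zero_two_one :
    inner 0 2 1 = SimplexCategory.mkOfLeComp (n := 3) 0 1 2 (by decide) (by decide) := by
  ext a; fin_cases a <;> rfl

theorem outer_zero_two_one :
    outer 0 2 1 = SimplexCategory.mkOfLeComp (n := 3) 0 2 3 (by decide) (by decide) := by
  ext a; fin_cases a <;> rfl

theorem inner_zero_three_one :
    inner 0 3 1 = tetrahedronMap (n := 4) 0 1 2 3 (by decide) (by decide) (by decide) := by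
  ext a; fin_cases a <;> rfl

theorem outer_zero_three_one :
    outer 0 3 1 = SimplexCategory.mkOfLeComp (n := 4) 0 3 4 (by decide) (by decide) := by
  ext a; fin_cases a <;> rfl

theorem inner_one_zero_zero : inner 1 0 0 = ⦋0⦌.const ⦋1⦌ 1 := by
  ext a; fin_cases a; rfl

theorem outer_one_zero_zero :
    outer 1 0 0 = SimplexCategory.mkOfLeComp (n := 1) 0 1 1 (by decide) (by decide) := by
  ext a; fin_cases a <;> rfl

theorem inner_one_one_zero : inner 1 1 0 = SimplexCategory.mkOfLe (n := 2) 1 2 (by decide) := by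
  ext a; fin_cases a <;> rfl

theorem inner_one_two_zero :
    inner 1 2 0 = SimplexCategory.mkOfLeComp (n := 3) 1 2 3 (by decide) (by decide) := by
  ext a; fin_cases a <;> rfl

theorem outer_one_two_zero :
    outer 1 2 0 = SimplexCategory.mkOfLeComp (n := 3) 0 1 3 (by decide) (by decide) := by
  ext a; fin_cases a <;> rfl

/-- The 2-Segal condition for the diagonal from `a` to `a + m` of the polygon with `a + m + b + 1`
vertices, with arbitrary expressions for the maps of the simplex category that occur. -/
theorem IsTwoSegal.isTwoPullback (hX : X.IsTwoSegal) (a m b : ℕ)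
    {φ : ⦋m⦌ ⟶ ⦋a + m + b⦌} {ψ : ⦋a + 1 + b⦌ ⟶ ⦋a + m + b⦌} {χ : ⦋1⦌ ⟶ ⦋a + 1 + b⦌}
    (hφ : inner a m b = φ) (hψ : outer a m b = ψ) (hχ : inner a 1 b = χ) :
    IsTwoPullback (X.pull φ) (X.pull ψ) (X.edge 0 (Fin.last m) (Fin.zero_le _)) (X.pull χ)
      (by subst hφ hψ hχ; rw [edge, pull_comp, pull_comp, diag_inner]) := by
  subst hφ hψ hχ
  exact hX a m b

/-! ### Faces of faces -/

theorem pull_pull_obj {l m n : ℕ} {ψ : ⦋l⦌ ⟶ ⦋m⦌} {φ : ⦋m⦌ ⟶ ⦋n⦌} {χ : ⦋l⦌ ⟶ ⦋n⦌}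
    (h : ψ ≫ φ = χ) (s : X.simplices n) :
    (X.pull ψ).obj ((X.pull φ).obj s) = (X.pull χ).obj s :=
  (Functor.congr_obj (X.pull_comp ψ φ) s).trans (by rw [h])

theorem edge_pull {m n : ℕ} (φ : ⦋m⦌ ⟶ ⦋n⦌) (s : X.simplices n) {a b : Fin (m + 1)} (hab : a ≤ b)
    {c d : Fin (n + 1)} (hcd : c ≤ d) (hc : φ.toOrderHom a = c) (hd : φ.toOrderHom b = d) :
    (X.edge a b hab).obj ((X.pull φ).obj s) = (X.edge c d hcd).obj s :=
  pull_pull_obj (ψ := SimplexCategory.mkOfLe a b hab) (χ := SimplexCategory.mkOfLe c d hcd)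
    (SimplexCategory.Hom.ext_one_left _ _ hc hd) s

/-- The tetrahedron of an `n`-simplex with vertices `i ≤ j ≤ k ≤ l`. -/
abbrev tetrahedron {n : ℕ} (i j k l : Fin (n + 1)) (hij : i ≤ j) (hjk : j ≤ k) (hkl : k ≤ l) :
    X.simplices n ⥤ X.simplices 3 :=
  X.pull (tetrahedronMap i j k l hij hjk hkl)

section

variable {n : ℕ} (i j k l : Fin (n + 1)) (hij : i ≤ j) (hjk : j ≤ k) (hkl : k ≤ l)
  (s : X.simplices n)

theorem triangle012_tetrahedron :
    (X.triangle 0 1 2 (by decide) (by decide)).obj ((tetrahedron i j k l hij hjk hkl).obj s) =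
      (X.triangle i j k hij hjk).obj s :=
  pull_pull_obj (by ext a; fin_cases a <;> rfl) s

theorem triangle023_tetrahedron :
    (X.triangle 0 2 3 (by decide) (by decide)).obj ((tetrahedron i j k l hij hjk hkl).obj s) =
      (X.triangle i k l (hij.trans hjk) hkl).obj s :=
  pull_pull_obj (by ext a; fin_cases a <;> rfl) s

theorem triangle123_tetrahedron :
    (X.triangle 1 2 3 (by decide) (by decide)).obj ((tetrahedron i j k l hij hjk hkl).obj s) =
      (X.triangle j k l hjk hkl).obj s :=
  pull_pull_obj (by ext a; fin_cases a <;> rfl) s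

theorem triangle013_tetrahedron :
    (X.triangle 0 1 3 (by decide) (by decide)).obj ((tetrahedron i j k l hij hjk hkl).obj s) =
      (X.triangle i j l hij (hjk.trans hkl)).obj s :=
  pull_pull_obj (by ext a; fin_cases a <;> rfl) s

theorem triangle001_edge :
    (X.triangle (n := 1) 0 0 1 le_rfl (by decide)).obj ((X.edge i j hij).obj s) =
      (X.triangle i i j le_rfl hij).obj s :=
  pull_pull_obj (by ext a; fin_cases a <;> rfl) s

theorem triangle011_edge :
    (X.triangle (n := 1) 0 1 1 (by decide) le_rfl).obj ((X.edge i j hij).obj s) =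
      (X.triangle i j j hij le_rfl).obj s :=
  pull_pull_obj (by ext a; fin_cases a <;> rfl) s

theorem vertex0_edge :
    (X.vertex (n := 1) 0).obj ((X.edge i j hij).obj s) = (X.vertex i).obj s :=
  pull_pull_obj (by ext a; fin_cases a; rfl) s

theorem vertex1_edge :
    (X.vertex (n := 1) 1).obj ((X.edge i j hij).obj s) = (X.vertex j).obj s :=
  pull_pull_obj (by ext a; fin_cases a; rfl) s

end

variable (X) in
/-- The edge functor of `1`-simplices is the identity, though not by definition: a left Kan
extension along it is the given functor. -/
theorem edge01_eq_id : X.edge (n := 1) 0 1 = 𝟭 _ := by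
  have : SimplexCategory.mkOfLe (n := 1) 0 1 (by decide) = 𝟙 _ := by
    ext a; fin_cases a <;> rfl
  rw [edge, this]
  exact X.map_id _

instance : (X.edge (n := 1) 0 1).IsEquivalence := by
  rw [edge01_eq_id]
  infer_instance

/-! ### Naturality in the functors -/

theorem conv_hom_ext {F G H : X.simplices 1 ⥤ V} {f g : conv F G ⟶ H}
    (h : ∀ t, convMulApp F G t ≫ f.app ((X.edge 0 2).obj t) =
      convMulApp F G t ≫ g.app ((X.edge 0 2).obj t)) : f = g :=
  Functor.hom_ext_of_isLeftKanExtension _ (convMul F G) _ _ (NatTrans.ext (funext h))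

theorem convUnit_hom_ext {H : X.simplices 1 ⥤ V} {f g : convUnit V X ⟶ H}
    (h : ∀ p, convOneApp V p ≫ f.app ((X.edge 0 0).obj p) =
      convOneApp V p ≫ g.app ((X.edge 0 0).obj p)) : f = g :=
  Functor.hom_ext_of_isLeftKanExtension _ (convOne V X) _ _ (NatTrans.ext (funext h))

/-- The tensor product of morphisms. -/
noncomputable def convMap {F F' G G' : X.simplices 1 ⥤ V} (α : F ⟶ F') (β : G ⟶ G') :
    conv F G ⟶ conv F' G' :=
  Functor.descOfIsLeftKanExtension _ (convMul F G) _
    ((Functor.whiskerLeft _ α ⊗ₘ Functor.whiskerLeft _ β) ≫ convMul F' G')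

theorem convMulApp_convMap {F F' G G' : X.simplices 1 ⥤ V} (α : F ⟶ F') (β : G ⟶ G')
    (t : X.simplices 2) :
    convMulApp F G t ≫ (convMap α β).app ((X.edge 0 2).obj t) =
      (α.app ((X.edge 0 1).obj t) ⊗ₘ β.app ((X.edge 1 2).obj t)) ≫ convMulApp F' G' t :=
  Functor.descOfIsLeftKanExtension_fac_app _ (convMul F G) _ _ t

theorem convMulAux_convMap {F F' G G' : X.simplices 1 ⥤ V} (α : F ⟶ F') (β : G ⟶ G')
    (t : X.simplices 2) {x y z : X.simplices 1}
    (hx : (X.edge 0 1).obj t = x) (hy : (X.edge 1 2).obj t = y) (hz : (X.edge 0 2).obj t = z) :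
    convMulAux F G t hx hy hz ≫ (convMap α β).app z =
      (α.app x ⊗ₘ β.app y) ≫ convMulAux F' G' t hx hy hz := by
  subst hx hy hz
  simp only [convMulAux, eqToHom_refl, CategoryTheory.Functor.map_id, id_tensorHom_id,
    Category.id_comp, Category.comp_id]
  exact convMulApp_convMap α β t

theorem convMulAt_convMap {F F' G G' : X.simplices 1 ⥤ V} (α : F ⟶ F') (β : G ⟶ G')
    {n : ℕ} (s : X.simplices n) (i j k : Fin (n + 1)) (hij : i ≤ j) (hjk : j ≤ k) :
    convMulAt F G s i j k hij hjk ≫ (convMap α β).app _ =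
      (α.app _ ⊗ₘ β.app _) ≫ convMulAt F' G' s i j k hij hjk :=
  convMulAux_convMap _ _ _ _ _ _

theorem convMulAt_convMap_assoc {F F' G G' : X.simplices 1 ⥤ V} (α : F ⟶ F') (β : G ⟶ G')
    {n : ℕ} (s : X.simplices n) (i j k : Fin (n + 1)) (hij : i ≤ j) (hjk : j ≤ k) {Z : V}
    (h : (conv F' G').obj ((X.edge i k (hij.trans hjk)).obj s) ⟶ Z) :
    convMulAt F G s i j k hij hjk ≫ (convMap α β).app _ ≫ h =
      (α.app _ ⊗ₘ β.app _) ≫ convMulAt F' G' s i j k hij hjk ≫ h := by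
  rw [← Category.assoc, convMulAt_convMap, Category.assoc]

theorem convMap_id (F G : X.simplices 1 ⥤ V) : convMap (𝟙 F) (𝟙 G) = 𝟙 (conv F G) :=
  conv_hom_ext fun t => by
    rw [convMulApp_convMap]
    simp

theorem convMap_comp {F F' F'' G G' G'' : X.simplices 1 ⥤ V} (α : F ⟶ F') (β : G ⟶ G')
    (α' : F' ⟶ F'') (β' : G' ⟶ G'') :
    convMap (α ≫ α') (β ≫ β') = convMap α β ≫ convMap α' β' :=
  conv_hom_ext fun t => by
    rw [convMulApp_convMap, NatTrans.comp_app, NatTrans.comp_app, NatTrans.comp_app,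
      ← Category.assoc, convMulApp_convMap, Category.assoc, convMulApp_convMap,
      MonoidalCategory.tensorHom_comp_tensorHom_assoc]

/-! ### Threefold products as left Kan extensions -/

/-- The map `(F (s_ij) ⊗ G (s_jk)) ⊗ K (s_kl) ⟶ ((F ⊗ G) ⊗ K) (s_il)`. -/
noncomputable def convMulNatLeft (F G K : X.simplices 1 ⥤ V) {n : ℕ} (i j k l : Fin (n + 1))
    (hij : i ≤ j := by decide) (hjk : j ≤ k := by decide) (hkl : k ≤ l := by decide) :
    ((X.edge i j hij ⋙ F) ⊗ (X.edge j k hjk ⋙ G)) ⊗ (X.edge k l hkl ⋙ K) ⟶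
      X.edge i l ((hij.trans hjk).trans hkl) ⋙ conv (conv F G) K :=
  (convMulNat F G i j k hij hjk ▷ _) ≫ convMulNat (conv F G) K i k l (hij.trans hjk) hkl

/-- The restriction of `F` to an edge of an `n`-simplex that is an edge of one of its faces. -/
noncomputable def edgeIso {m n : ℕ} (φ : ⦋m⦌ ⟶ ⦋n⦌) {ψ : ⦋1⦌ ⟶ ⦋m⦌} {χ : ⦋1⦌ ⟶ ⦋n⦌}
    (F : X.simplices 1 ⥤ V) (h : ψ ≫ φ = χ) :
    X.pull χ ⋙ F ≅ X.pull φ ⋙ (X.pull ψ ⋙ F) :=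
  NatIso.ofComponents (fun s => F.mapIso (eqToIso (pull_pull_obj h s).symm)) (by
    intro s s' f
    have h₁ : X.pull χ = X.pull φ ⋙ X.pull ψ := by rw [pull_comp, h]
    have h₂ := Functor.congr_hom h₁ f
    change F.map ((X.pull χ).map f) ≫ F.map (eqToHom (pull_pull_obj h s').symm) =
      F.map (eqToHom (pull_pull_obj h s).symm) ≫ F.map ((X.pull φ ⋙ X.pull ψ).map f)
    rw [← F.map_comp, ← F.map_comp, h₂]
    simp)

/-- The map `convMulNatLeft` at vertices `i ≤ j ≤ k ≤ l` of a simplex is, up to transport along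
equalities of edges, the universal map at the tetrahedron on these vertices. -/
theorem convMulNatLeft_tetrahedron (F G K : X.simplices 1 ⥤ V) {n : ℕ} (s : X.simplices n)
    (i j k l : Fin (n + 1)) (hij : i ≤ j) (hjk : j ≤ k) (hkl : k ≤ l) :
    (convMulNatLeft F G K i j k l hij hjk hkl).app s =
      ((F.map (eqToHom (edge_pull (tetrahedronMap i j k l hij hjk hkl) s
          (a := 0) (b := 1) (by decide) hij rfl rfl).symm) ⊗ₘ
        G.map (eqToHom (edge_pull (tetrahedronMap i j k l hij hjk hkl) s
          (a := 1) (b := 2) (by decide) hjk rfl rfl).symm)) ⊗ₘ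
        K.map (eqToHom (edge_pull (tetrahedronMap i j k l hij hjk hkl) s
          (a := 2) (b := 3) (by decide) hkl rfl rfl).symm)) ≫
      (convMulNatLeft F G K 0 1 2 3).app ((tetrahedron i j k l hij hjk hkl).obj s) ≫
        (conv (conv F G) K).map (eqToHom (edge_pull (tetrahedronMap i j k l hij hjk hkl) s
          (a := 0) (b := 3) (by decide) ((hij.trans hjk).trans hkl) rfl rfl)) := by
  -- Once the simplices and edges are variables, all equalities can be substituted.
  change convMulAt F G s i j k hij hjk ▷ _ ≫ convMulAt (conv F G) K s i k l _ hkl =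
    _ ≫ (convMulAt F G _ 0 1 2 ▷ _ ≫ convMulAt (conv F G) K _ 0 2 3) ≫ _
  have key : ∀ {t t' u u' : X.simplices 2} (_ : t' = t) (_ : u' = u)
      {x x' y y' z z' w w' v v' : X.simplices 1}
      (hx : (X.edge 0 1).obj t = x) (hy : (X.edge 1 2).obj t = y) (hw : (X.edge 0 2).obj t = w)
      (gw : (X.edge 0 1).obj u = w) (hz : (X.edge 1 2).obj u = z) (hv : (X.edge 0 2).obj u = v)
      (hx' : (X.edge 0 1).obj t' = x') (hy' : (X.edge 1 2).obj t' = y')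
      (hw' : (X.edge 0 2).obj t' = w') (gw' : (X.edge 0 1).obj u' = w')
      (hz' : (X.edge 1 2).obj u' = z') (hv' : (X.edge 0 2).obj u' = v')
      (ex : x = x') (ey : y = y') (ez : z = z') (ev : v' = v),
      convMulAux F G t hx hy hw ▷ K.obj z ≫ convMulAux (conv F G) K u gw hz hv =
        ((F.map (eqToHom ex) ⊗ₘ G.map (eqToHom ey)) ⊗ₘ K.map (eqToHom ez)) ≫
          (convMulAux F G t' hx' hy' hw' ▷ K.obj z' ≫
            convMulAux (conv F G) K u' gw' hz' hv') ≫
            (conv (conv F G) K).map (eqToHom ev) := by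
    intro t t' u u' ht hu x x' y y' z z' w w' v v' hx hy hw gw hz hv hx' hy' hw' gw' hz' hv' _ _ _ _
    subst ht hu hx hy hw hx' hy' hw' hz hz' hv hv'
    simp
  exact key (triangle012_tetrahedron ..) (triangle023_tetrahedron ..) ..

section IsLeftKanExtension

/-- The universal map `(F (s_01) ⊗ G (s_12)) ⊗ K (s_23) ⟶ ((F ⊗ G) ⊗ K) (s_03)` on `X_3`. -/
noncomputable def convMulLeft (F G K : X.simplices 1 ⥤ V) :
    ((X.edge 0 1 ⋙ F) ⊗ (X.edge 1 2 ⋙ G)) ⊗ (X.edge 2 3 ⋙ K) ⟶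
      X.edge (n := 3) 0 3 ⋙ conv (conv F G) K :=
  convMulNatLeft F G K 0 1 2 3

/-- The universal map `F (s_01) ⊗ (G (s_12) ⊗ K (s_23)) ⟶ (F ⊗ (G ⊗ K)) (s_03)` on `X_3`. -/
noncomputable def convMulRight (F G K : X.simplices 1 ⥤ V) :
    (X.edge 0 1 ⋙ F) ⊗ ((X.edge 1 2 ⋙ G) ⊗ (X.edge 2 3 ⋙ K)) ⟶
      X.edge (n := 3) 0 3 ⋙ conv F (conv G K) :=
  (_ ◁ convMulNat G K 1 2 3) ≫ convMulNat F (conv G K) 0 1 3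

variable [hX : Fact X.IsTwoSegal]

/-- The product `(F ⊗ G) ⊗ K` is a left Kan extension from `X_3`, by the 2-Segal condition for the
subdivision of the square along the diagonal `0 2`. -/
instance convMulLeft_isLeftKanExtension
    [∀ A : V, Limits.PreservesColimitsOfSize.{w, w} (tensorRight A)]
    (F G K : X.simplices 1 ⥤ V) :
    (conv (conv F G) K).IsLeftKanExtension (convMulLeft F G K) := by
  refine isLeftKanExtension_convMul_right _ 0 2 3 _ _
    (hX.out.isTwoPullback 0 2 1 inner_zero_two_one outer_zero_two_one inner_zero_one_one)
    (convMul F G) _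
    (edgeIso _ F (SimplexCategory.Hom.ext_one_left _ _) ⊗ᵢ
      edgeIso _ G (SimplexCategory.Hom.ext_one_left _ _)) ?_ K
  intro s
  rfl

/-- The product `F ⊗ (G ⊗ K)` is a left Kan extension from `X_3`, by the 2-Segal condition for the
subdivision of the square along the diagonal `1 3`. -/
instance convMulRight_isLeftKanExtension
    [∀ A : V, Limits.PreservesColimitsOfSize.{w, w} (tensorLeft A)]
    (F G K : X.simplices 1 ⥤ V) :
    (conv F (conv G K)).IsLeftKanExtension (convMulRight F G K) := by
  refine isLeftKanExtension_convMul_left _ 0 1 3 _ _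
    (hX.out.isTwoPullback 1 2 0 inner_one_two_zero outer_one_two_zero inner_one_one_zero)
    (convMul G K) _
    (edgeIso _ G (SimplexCategory.Hom.ext_one_left _ _) ⊗ᵢ
      edgeIso _ K (SimplexCategory.Hom.ext_one_left _ _)) ?_ F
  intro s
  rfl

end IsLeftKanExtension

/-! ### Fourfold products and products with the unit as left Kan extensions -/

/-- The map `F (s_ij) ⊗ 1 ⟶ (F ⊗ 𝟙) (s_ij)`, from the vertex `j` and the degenerate triangle
`s_ijj`. -/
noncomputable def convMulOneNat (F : X.simplices 1 ⥤ V) {n : ℕ} (i j : Fin (n + 1))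
    (hij : i ≤ j := by decide) :
    (X.edge i j hij ⋙ F) ⊗ (Functor.const (X.simplices n)).obj (𝟙_ V) ⟶
      X.edge i j hij ⋙ conv F (convUnit V X) :=
  (_ ◁ convOneNat j) ≫ convMulNat F (convUnit V X) i j j hij le_rfl

/-- The map `convMulOneNat` at an edge of a simplex is, up to transport along equalities of edges,
the one of that edge regarded as a `1`-simplex. -/
theorem convMulOneNat_edge (F : X.simplices 1 ⥤ V) {n : ℕ} (s : X.simplices n)
    (i j : Fin (n + 1)) (hij : i ≤ j) :
    (convMulOneNat F i j hij).app s =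
      (F.map (eqToHom (edge_pull (SimplexCategory.mkOfLe i j hij) s
          (a := 0) (b := 1) (by decide) hij rfl rfl).symm) ▷ 𝟙_ V) ≫
      (convMulOneNat F 0 1).app ((X.edge i j hij).obj s) ≫
        (conv F (convUnit V X)).map (eqToHom (edge_pull (SimplexCategory.mkOfLe i j hij) s
          (a := 0) (b := 1) (by decide) hij rfl rfl)) := by
  -- Once the simplices and edges are variables, all equalities can be substituted.
  change _ ◁ convOneAt s j ≫ convMulAt F _ s i j j hij le_rfl =
    _ ≫ (_ ◁ convOneAt _ 1 ≫ convMulAt F _ _ 0 1 1) ≫ _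
  have key : ∀ {t t' : X.simplices 2} (_ : t' = t) {p p' : X.simplices 0} (_ : p' = p)
      {x x' y y' z z' : X.simplices 1}
      (hx : (X.edge 0 1).obj t = x) (hy : (X.edge 1 2).obj t = y) (hz : (X.edge 0 2).obj t = z)
      (hp : (X.edge 0 0).obj p = y)
      (hx' : (X.edge 0 1).obj t' = x') (hy' : (X.edge 1 2).obj t' = y')
      (hz' : (X.edge 0 2).obj t' = z') (hp' : (X.edge 0 0).obj p' = y')
      (ex : x = x') (ez : z' = z),
      F.obj x ◁ convOneAux p hp ≫ convMulAux F (convUnit V X) t hx hy hz =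
        (F.map (eqToHom ex) ▷ 𝟙_ V) ≫
          (F.obj x' ◁ convOneAux p' hp' ≫ convMulAux F (convUnit V X) t' hx' hy' hz') ≫
            (conv F (convUnit V X)).map (eqToHom ez) := by
    intro t t' ht p p' hp x x' y y' z z' hx hy hz gp hx' hy' hz' gp' _ _
    subst ht hp hx hy hz hx' hy' hz'
    simp
  exact key (triangle011_edge ..) (vertex1_edge ..) ..

section IsLeftKanExtension

/-- The universal map
`((F (s_01) ⊗ G (s_12)) ⊗ K (s_23)) ⊗ M (s_34) ⟶ (((F ⊗ G) ⊗ K) ⊗ M) (s_04)` on `X_4`. -/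
noncomputable def convMulFourfold (F G K M : X.simplices 1 ⥤ V) :
    (((X.edge 0 1 ⋙ F) ⊗ (X.edge 1 2 ⋙ G)) ⊗ (X.edge 2 3 ⋙ K)) ⊗ (X.edge 3 4 ⋙ M) ⟶
      X.edge (n := 4) 0 4 ⋙ conv (conv (conv F G) K) M :=
  (convMulNatLeft F G K 0 1 2 3 ▷ _) ≫ convMulNat (conv (conv F G) K) M 0 3 4

/-- The universal map `1 ⊗ F (x_01) ⟶ (𝟙 ⊗ F) (x_01)` on `X_1`. -/
noncomputable def convOneMul (F : X.simplices 1 ⥤ V) :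
    (Functor.const (X.simplices 1)).obj (𝟙_ V) ⊗ (X.edge 0 1 ⋙ F) ⟶
      X.edge (n := 1) 0 1 ⋙ conv (convUnit V X) F :=
  (convOneNat 0 ▷ _) ≫ convMulNat (convUnit V X) F 0 0 1

/-- The universal map `F (x_01) ⊗ 1 ⟶ (F ⊗ 𝟙) (x_01)` on `X_1`. -/
noncomputable def convMulOne (F : X.simplices 1 ⥤ V) :
    (X.edge 0 1 ⋙ F) ⊗ (Functor.const (X.simplices 1)).obj (𝟙_ V) ⟶
      X.edge (n := 1) 0 1 ⋙ conv F (convUnit V X) :=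
  convMulOneNat F 0 1

/-- The universal map `(F (t_01) ⊗ 1) ⊗ G (t_12) ⟶ ((F ⊗ 𝟙) ⊗ G) (t_02)` on `X_2`. -/
noncomputable def convMulOneMul (F G : X.simplices 1 ⥤ V) :
    ((X.edge 0 1 ⋙ F) ⊗ (Functor.const (X.simplices 2)).obj (𝟙_ V)) ⊗ (X.edge 1 2 ⋙ G) ⟶
      X.edge (n := 2) 0 2 ⋙ conv (conv F (convUnit V X)) G :=
  (convMulOneNat F 0 1 ▷ _) ≫ convMulNat (conv F (convUnit V X)) G 0 1 2

variable [hX : Fact X.IsTwoSegal]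

/-- The fourfold product `((F ⊗ G) ⊗ K) ⊗ M` is a left Kan extension from `X_4`, by the 2-Segal
condition for the subdivision of the pentagon along the diagonal `0 3`. -/
instance [∀ A : V, Limits.PreservesColimitsOfSize.{w, w} (tensorRight A)]
    (F G K M : X.simplices 1 ⥤ V) :
    (conv (conv (conv F G) K) M).IsLeftKanExtension
      (convMulFourfold F G K M) := by
  refine isLeftKanExtension_convMul_right _ 0 3 4 _ _
    (hX.out.isTwoPullback 0 3 1 inner_zero_three_one outer_zero_three_one inner_zero_one_one)
    (convMulLeft F G K) _
    ((edgeIso _ F (SimplexCategory.Hom.ext_one_left _ _) ⊗ᵢ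
      edgeIso _ G (SimplexCategory.Hom.ext_one_left _ _)) ⊗ᵢ
      edgeIso _ K (SimplexCategory.Hom.ext_one_left _ _)) ?_ M
  intro s
  exact convMulNatLeft_tetrahedron F G K s 0 1 2 3 _ _ _

/-- The product `𝟙 ⊗ F` is a left Kan extension from `X_1`, by unitality at the vertex `0`. -/
instance [∀ A : V, Limits.PreservesColimitsOfSize.{w, w} (tensorRight A)]
    (F : X.simplices 1 ⥤ V) :
    (conv (convUnit V X) F).IsLeftKanExtension (convOneMul F) := by
  refine isLeftKanExtension_convMul_right _ 0 0 1 _ _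
    (hX.out.isTwoPullback 0 0 1 inner_zero_zero_one outer_zero_zero_one inner_zero_one_one)
    (convOne V X) (convOneNat 0) (NatIso.ofComponents fun _ => Iso.refl _) ?_ F
  intro s
  exact (Category.id_comp _).symm

/-- The product `F ⊗ 𝟙` is a left Kan extension from `X_1`, by unitality at the vertex `1`. -/
instance [∀ A : V, Limits.PreservesColimitsOfSize.{w, w} (tensorLeft A)]
    (F : X.simplices 1 ⥤ V) :
    (conv F (convUnit V X)).IsLeftKanExtension (convMulOne F) := by
  refine isLeftKanExtension_convMul_left _ 0 1 1 _ _
    (hX.out.isTwoPullback 1 0 0 inner_one_zero_zero outer_one_zero_zero inner_one_one_zero)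
    (convOne V X) (convOneNat 1) (NatIso.ofComponents fun _ => Iso.refl _) ?_ F
  intro s
  exact (Category.id_comp _).symm

/-- The product `(F ⊗ 𝟙) ⊗ G` is a left Kan extension from `X_2`. The 2-pullback square that occurs
is the void 2-Segal condition for an edge, since `F ⊗ 𝟙` is already a left Kan extension from
`X_1`. -/
instance [∀ A : V, Limits.PreservesColimitsOfSize.{w, w} (tensorLeft A)]
    [∀ A : V, Limits.PreservesColimitsOfSize.{w, w} (tensorRight A)]
    (F G : X.simplices 1 ⥤ V) :
    (conv (conv F (convUnit V X)) G).IsLeftKanExtension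
      (convMulOneMul F G) := by
  refine isLeftKanExtension_convMul_right _ 0 1 2 _ _
    (hX.out.isTwoPullback 0 1 1 inner_zero_one_one outer_zero_one_one inner_zero_one_one)
    (convMulOne F) _
    (whiskerRightIso (edgeIso _ F (SimplexCategory.Hom.ext_one_left _ _)) _) ?_ G
  intro s
  exact convMulOneNat_edge F s 0 1 _

end IsLeftKanExtension

variable [Fact X.IsTwoSegal]

/-! ### Associator and unitors of the convolution product -/

theorem conv_conv_hom_ext [∀ A : V, Limits.PreservesColimitsOfSize.{w, w} (tensorRight A)]
    {F G K H : X.simplices 1 ⥤ V} {f g : conv (conv F G) K ⟶ H}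
    (h : ∀ s : X.simplices 3,
      convMulAt F G s 0 1 2 ▷ K.obj ((X.edge 2 3).obj s) ≫
        convMulAt (conv F G) K s 0 2 3 ≫ f.app ((X.edge 0 3).obj s) =
      convMulAt F G s 0 1 2 ▷ K.obj ((X.edge 2 3).obj s) ≫
        convMulAt (conv F G) K s 0 2 3 ≫ g.app ((X.edge 0 3).obj s)) : f = g := by
  refine Functor.hom_ext_of_isLeftKanExtension _ (convMulLeft F G K) _ _ ?_
  ext s
  exact (Category.assoc _ _ _).trans ((h s).trans (Category.assoc _ _ _).symm)

theorem conv_conv_conv_hom_ext [∀ A : V, Limits.PreservesColimitsOfSize.{w, w} (tensorRight A)]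
    {F G K M H : X.simplices 1 ⥤ V} {f g : conv (conv (conv F G) K) M ⟶ H}
    (h : ∀ s : X.simplices 4,
      (convMulAt F G s 0 1 2 ▷ K.obj ((X.edge 2 3).obj s) ≫ convMulAt (conv F G) K s 0 2 3) ▷
          M.obj ((X.edge 3 4).obj s) ≫
        convMulAt (conv (conv F G) K) M s 0 3 4 ≫ f.app ((X.edge 0 4).obj s) =
      (convMulAt F G s 0 1 2 ▷ K.obj ((X.edge 2 3).obj s) ≫ convMulAt (conv F G) K s 0 2 3) ▷
          M.obj ((X.edge 3 4).obj s) ≫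
        convMulAt (conv (conv F G) K) M s 0 3 4 ≫ g.app ((X.edge 0 4).obj s)) : f = g := by
  refine Functor.hom_ext_of_isLeftKanExtension _
    (convMulFourfold F G K M) _ _ ?_
  ext s
  exact (Category.assoc _ _ _).trans ((h s).trans (Category.assoc _ _ _).symm)

theorem convUnit_conv_hom_ext [∀ A : V, Limits.PreservesColimitsOfSize.{w, w} (tensorRight A)]
    {F H : X.simplices 1 ⥤ V} {f g : conv (convUnit V X) F ⟶ H}
    (h : ∀ s : X.simplices 1,
      convOneAt s 0 ▷ F.obj ((X.edge 0 1).obj s) ≫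
        convMulAt (convUnit V X) F s 0 0 1 ≫ f.app ((X.edge 0 1).obj s) =
      convOneAt s 0 ▷ F.obj ((X.edge 0 1).obj s) ≫
        convMulAt (convUnit V X) F s 0 0 1 ≫ g.app ((X.edge 0 1).obj s)) : f = g := by
  refine Functor.hom_ext_of_isLeftKanExtension _ (convOneMul F) _ _ ?_
  ext s
  exact (Category.assoc _ _ _).trans ((h s).trans (Category.assoc _ _ _).symm)

theorem conv_convUnit_hom_ext [∀ A : V, Limits.PreservesColimitsOfSize.{w, w} (tensorLeft A)]
    {F H : X.simplices 1 ⥤ V} {f g : conv F (convUnit V X) ⟶ H}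
    (h : ∀ s : X.simplices 1,
      F.obj ((X.edge 0 1).obj s) ◁ convOneAt s 1 ≫
        convMulAt F (convUnit V X) s 0 1 1 ≫ f.app ((X.edge 0 1).obj s) =
      F.obj ((X.edge 0 1).obj s) ◁ convOneAt s 1 ≫
        convMulAt F (convUnit V X) s 0 1 1 ≫ g.app ((X.edge 0 1).obj s)) : f = g := by
  refine Functor.hom_ext_of_isLeftKanExtension _ (convMulOne F) _ _ ?_
  ext s
  exact (Category.assoc _ _ _).trans ((h s).trans (Category.assoc _ _ _).symm)

theorem conv_convUnit_conv_hom_ext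
    [∀ A : V, Limits.PreservesColimitsOfSize.{w, w} (tensorLeft A)]
    [∀ A : V, Limits.PreservesColimitsOfSize.{w, w} (tensorRight A)]
    {F G H : X.simplices 1 ⥤ V} {f g : conv (conv F (convUnit V X)) G ⟶ H}
    (h : ∀ s : X.simplices 2,
      (F.obj ((X.edge 0 1).obj s) ◁ convOneAt s 1 ≫ convMulAt F (convUnit V X) s 0 1 1) ▷
          G.obj ((X.edge 1 2).obj s) ≫
        convMulAt (conv F (convUnit V X)) G s 0 1 2 ≫ f.app ((X.edge 0 2).obj s) =
      (F.obj ((X.edge 0 1).obj s) ◁ convOneAt s 1 ≫ convMulAt F (convUnit V X) s 0 1 1) ▷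
          G.obj ((X.edge 1 2).obj s) ≫
        convMulAt (conv F (convUnit V X)) G s 0 1 2 ≫ g.app ((X.edge 0 2).obj s)) : f = g := by
  refine Functor.hom_ext_of_isLeftKanExtension _
    (convMulOneMul F G) _ _ ?_
  ext s
  exact (Category.assoc _ _ _).trans ((h s).trans (Category.assoc _ _ _).symm)

section LeftUnitor

variable [∀ A : V, Limits.PreservesColimitsOfSize.{w, w} (tensorRight A)]

/-- The left unitor: `𝟙 ⊗ F` is a left Kan extension of `F` along the identity. -/
noncomputable def convLeftUnitor (F : X.simplices 1 ⥤ V) : conv (convUnit V X) F ≅ F :=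
  Functor.leftKanExtensionUnique _ (convOneMul F) _ (λ_ (X.edge 0 1 ⋙ F)).hom

theorem convLeftUnitor_hom_app (F : X.simplices 1 ⥤ V) (x : X.simplices 1) :
    convOneAt x 0 ▷ F.obj ((X.edge 0 1).obj x) ≫
        convMulAt (convUnit V X) F x 0 0 1 ≫
          (convLeftUnitor F).hom.app ((X.edge 0 1).obj x) = (λ_ _).hom :=
  (Category.assoc _ _ _).symm.trans
    ((Functor.descOfIsLeftKanExtension_fac_app _ (convOneMul F) _
      (𝟙 _ ≫ (λ_ (X.edge 0 1 ⋙ F)).hom) x).trans (Category.id_comp _))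

/-- The characterization of the left unitor, with arbitrary expressions for the degenerate
triangle and the vertex of an edge `r`. -/
theorem convMulAux_convLeftUnitor (F : X.simplices 1 ⥤ V) (r : X.simplices 1)
    {t : X.simplices 2} {p : X.simplices 0} {x e : X.simplices 1}
    (ht : (X.triangle (n := 1) 0 0 1 le_rfl (by decide)).obj r = t)
    (hp : (X.vertex (n := 1) 0).obj r = p)
    (h₁ : (X.edge 0 0).obj p = e) (h₂ : (X.edge 0 1).obj t = e) (h₃ : (X.edge 1 2).obj t = x)
    (h₄ : (X.edge 0 2).obj t = x) :
    convOneAux p h₁ ▷ F.obj x ≫ convMulAux (convUnit V X) F t h₂ h₃ h₄ ≫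
      (convLeftUnitor F).hom.app x = (λ_ _).hom := by
  subst ht hp
  obtain rfl := (edge01_triangle (X := X) (n := 1) 0 0 1 _ _ r).symm.trans h₂
  obtain rfl := (edge12_triangle (X := X) (n := 1) 0 0 1 _ _ r).symm.trans h₃
  exact convLeftUnitor_hom_app F r

/-- The characterization of the left unitor, at an edge of an `n`-simplex. -/
theorem convMulAt_convLeftUnitor (F : X.simplices 1 ⥤ V) {n : ℕ} (s : X.simplices n)
    (i j : Fin (n + 1)) (hij : i ≤ j) :
    convOneAt s i ▷ F.obj ((X.edge i j hij).obj s) ≫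
        convMulAt (convUnit V X) F s i i j le_rfl hij ≫
          (convLeftUnitor F).hom.app ((X.edge i j hij).obj s) = (λ_ _).hom :=
  convMulAux_convLeftUnitor F ((X.edge i j hij).obj s) (triangle001_edge ..) (vertex0_edge ..) ..

end LeftUnitor

section RightUnitor

variable [∀ A : V, Limits.PreservesColimitsOfSize.{w, w} (tensorLeft A)]

/-- The right unitor: `F ⊗ 𝟙` is a left Kan extension of `F` along the identity. -/
noncomputable def convRightUnitor (F : X.simplices 1 ⥤ V) : conv F (convUnit V X) ≅ F :=
  Functor.leftKanExtensionUnique _ (convMulOne F) _ (ρ_ (X.edge 0 1 ⋙ F)).hom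

theorem convRightUnitor_hom_app (F : X.simplices 1 ⥤ V) (x : X.simplices 1) :
    F.obj ((X.edge 0 1).obj x) ◁ convOneAt x 1 ≫
        convMulAt F (convUnit V X) x 0 1 1 ≫
          (convRightUnitor F).hom.app ((X.edge 0 1).obj x) = (ρ_ _).hom :=
  (Category.assoc _ _ _).symm.trans
    ((Functor.descOfIsLeftKanExtension_fac_app _ (convMulOne F) _
      (𝟙 _ ≫ (ρ_ (X.edge 0 1 ⋙ F)).hom) x).trans (Category.id_comp _))

/-- The characterization of the right unitor, with arbitrary expressions for the degenerate
triangle and the vertex of an edge `r`. -/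
theorem convMulAux_convRightUnitor (F : X.simplices 1 ⥤ V) (r : X.simplices 1)
    {t : X.simplices 2} {p : X.simplices 0} {x e : X.simplices 1}
    (ht : (X.triangle (n := 1) 0 1 1 (by decide) le_rfl).obj r = t)
    (hp : (X.vertex (n := 1) 1).obj r = p)
    (h₁ : (X.edge 0 0).obj p = e) (h₂ : (X.edge 0 1).obj t = x) (h₃ : (X.edge 1 2).obj t = e)
    (h₄ : (X.edge 0 2).obj t = x) :
    F.obj x ◁ convOneAux p h₁ ≫ convMulAux F (convUnit V X) t h₂ h₃ h₄ ≫
      (convRightUnitor F).hom.app x = (ρ_ _).hom := by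
  subst ht hp
  obtain rfl := (edge01_triangle (X := X) (n := 1) 0 1 1 _ _ r).symm.trans h₂
  obtain rfl := (edge12_triangle (X := X) (n := 1) 0 1 1 _ _ r).symm.trans h₃
  exact convRightUnitor_hom_app F r

/-- The characterization of the right unitor, at an edge of an `n`-simplex. -/
theorem convMulAt_convRightUnitor (F : X.simplices 1 ⥤ V) {n : ℕ} (s : X.simplices n)
    (i j : Fin (n + 1)) (hij : i ≤ j) :
    F.obj ((X.edge i j hij).obj s) ◁ convOneAt s j ≫
        convMulAt F (convUnit V X) s i j j hij le_rfl ≫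
          (convRightUnitor F).hom.app ((X.edge i j hij).obj s) = (ρ_ _).hom :=
  convMulAux_convRightUnitor F ((X.edge i j hij).obj s) (triangle011_edge ..) (vertex1_edge ..) ..

end RightUnitor

section Associator

variable [∀ A : V, Limits.PreservesColimitsOfSize.{w, w} (tensorLeft A)]
  [∀ A : V, Limits.PreservesColimitsOfSize.{w, w} (tensorRight A)]

/-- The associator: both threefold products are left Kan extensions from `X_3`. -/
noncomputable def convAssociator (F G K : X.simplices 1 ⥤ V) :
    conv (conv F G) K ≅ conv F (conv G K) :=
  Functor.leftKanExtensionUniqueOfIso _ (convMulLeft F G K) (α_ _ _ _)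
    _ (convMulRight F G K)

theorem convAssociator_hom_app (F G K : X.simplices 1 ⥤ V) (s : X.simplices 3) :
    convMulAt F G s 0 1 2 ▷ K.obj ((X.edge 2 3).obj s) ≫
        convMulAt (conv F G) K s 0 2 3 ≫
          (convAssociator F G K).hom.app ((X.edge 0 3).obj s) =
      (α_ _ _ _).hom ≫ F.obj ((X.edge 0 1).obj s) ◁ convMulAt G K s 1 2 3 ≫
          convMulAt F (conv G K) s 0 1 3 :=
  (Category.assoc _ _ _).symm.trans
    (Functor.descOfIsLeftKanExtension_fac_app _ (convMulLeft F G K) _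
      ((α_ _ _ _).hom ≫ convMulRight F G K) s)

/-- The characterization of the associator, with arbitrary expressions for the faces of a
tetrahedron `r`. -/
theorem convMulAux_convAssociator (F G K : X.simplices 1 ⥤ V) (r : X.simplices 3)
    {t u t' u' : X.simplices 2} {x y z a b c : X.simplices 1}
    (ht : (X.triangle 0 1 2 (by decide) (by decide)).obj r = t)
    (hu : (X.triangle 0 2 3 (by decide) (by decide)).obj r = u)
    (ht' : (X.triangle 1 2 3 (by decide) (by decide)).obj r = t')
    (hu' : (X.triangle 0 1 3 (by decide) (by decide)).obj r = u')
    (h₁ : (X.edge 0 1).obj t = x) (h₂ : (X.edge 1 2).obj t = y) (h₃ : (X.edge 0 2).obj t = a)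
    (h₄ : (X.edge 0 1).obj u = a) (h₅ : (X.edge 1 2).obj u = z) (h₆ : (X.edge 0 2).obj u = c)
    (h₇ : (X.edge 0 1).obj t' = y) (h₈ : (X.edge 1 2).obj t' = z)
    (h₉ : (X.edge 0 2).obj t' = b) (g₁ : (X.edge 0 1).obj u' = x)
    (g₂ : (X.edge 1 2).obj u' = b) (g₃ : (X.edge 0 2).obj u' = c) :
    convMulAux F G t h₁ h₂ h₃ ▷ K.obj z ≫ convMulAux (conv F G) K u h₄ h₅ h₆ ≫
        (convAssociator F G K).hom.app c =
      (α_ _ _ _).hom ≫ F.obj x ◁ convMulAux G K t' h₇ h₈ h₉ ≫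
        convMulAux F (conv G K) u' g₁ g₂ g₃ := by
  subst ht hu ht' hu'
  obtain rfl := (edge01_triangle (X := X) (n := 3) 0 1 2 _ _ r).symm.trans h₁
  obtain rfl := (edge12_triangle (X := X) (n := 3) 0 1 2 _ _ r).symm.trans h₂
  obtain rfl := (edge02_triangle (X := X) (n := 3) 0 1 2 _ _ r).symm.trans h₃
  obtain rfl := (edge12_triangle (X := X) (n := 3) 0 2 3 _ _ r).symm.trans h₅
  obtain rfl := (edge02_triangle (X := X) (n := 3) 0 2 3 _ _ r).symm.trans h₆
  obtain rfl := (edge02_triangle (X := X) (n := 3) 1 2 3 _ _ r).symm.trans h₉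
  exact convAssociator_hom_app F G K r

/-- The characterization of the associator, at a tetrahedron of an `n`-simplex. -/
theorem convMulAt_convAssociator (F G K : X.simplices 1 ⥤ V) {n : ℕ} (s : X.simplices n)
    (i j k l : Fin (n + 1)) (hij : i ≤ j) (hjk : j ≤ k) (hkl : k ≤ l) :
    convMulAt F G s i j k hij hjk ▷ K.obj ((X.edge k l hkl).obj s) ≫
        convMulAt (conv F G) K s i k l (hij.trans hjk) hkl ≫
          (convAssociator F G K).hom.app ((X.edge i l ((hij.trans hjk).trans hkl)).obj s) =
      (α_ _ _ _).hom ≫ F.obj ((X.edge i j hij).obj s) ◁ convMulAt G K s j k l hjk hkl ≫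
          convMulAt F (conv G K) s i j l hij (hjk.trans hkl) :=
  convMulAux_convAssociator F G K ((tetrahedron i j k l hij hjk hkl).obj s)
    (triangle012_tetrahedron ..) (triangle023_tetrahedron ..) (triangle123_tetrahedron ..)
    (triangle013_tetrahedron ..) ..

theorem convMulAt_convAssociator_assoc (F G K : X.simplices 1 ⥤ V) {n : ℕ} (s : X.simplices n)
    (i j k l : Fin (n + 1)) (hij : i ≤ j) (hjk : j ≤ k) (hkl : k ≤ l) {Z : V}
    (h : (conv F (conv G K)).obj ((X.edge i l ((hij.trans hjk).trans hkl)).obj s) ⟶ Z) :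
    convMulAt F G s i j k hij hjk ▷ K.obj ((X.edge k l hkl).obj s) ≫
        convMulAt (conv F G) K s i k l (hij.trans hjk) hkl ≫
          (convAssociator F G K).hom.app ((X.edge i l ((hij.trans hjk).trans hkl)).obj s) ≫ h =
      (α_ _ _ _).hom ≫ F.obj ((X.edge i j hij).obj s) ◁ convMulAt G K s j k l hjk hkl ≫
          convMulAt F (conv G K) s i j l hij (hjk.trans hkl) ≫ h := by
  simpa only [Category.assoc] using
    congrArg (· ≫ h) (convMulAt_convAssociator F G K s i j k l hij hjk hkl)

end Associator

/-! ### The axioms of a monoidal category -/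

theorem convLeftUnitor_naturality
    [∀ A : V, Limits.PreservesColimitsOfSize.{w, w} (tensorRight A)]
    {F G : X.simplices 1 ⥤ V} (α : F ⟶ G) :
    convMap (𝟙 (convUnit V X)) α ≫ (convLeftUnitor G).hom = (convLeftUnitor F).hom ≫ α := by
  refine convUnit_conv_hom_ext fun x => ?_
  rw [NatTrans.comp_app, NatTrans.comp_app, convMulAt_convMap_assoc, NatTrans.id_app,
    id_tensorHom, ← whisker_exchange_assoc, convMulAt_convLeftUnitor,
    reassoc_of% convMulAt_convLeftUnitor F x 0 1 (by decide), leftUnitor_naturality]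

theorem convRightUnitor_naturality
    [∀ A : V, Limits.PreservesColimitsOfSize.{w, w} (tensorLeft A)]
    {F G : X.simplices 1 ⥤ V} (α : F ⟶ G) :
    convMap α (𝟙 (convUnit V X)) ≫ (convRightUnitor G).hom = (convRightUnitor F).hom ≫ α := by
  refine conv_convUnit_hom_ext fun x => ?_
  rw [NatTrans.comp_app, NatTrans.comp_app, convMulAt_convMap_assoc, NatTrans.id_app,
    tensorHom_id, whisker_exchange_assoc, convMulAt_convRightUnitor,
    reassoc_of% convMulAt_convRightUnitor F x 0 1 (by decide), rightUnitor_naturality]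

variable [∀ A : V, Limits.PreservesColimitsOfSize.{w, w} (tensorLeft A)]
  [∀ A : V, Limits.PreservesColimitsOfSize.{w, w} (tensorRight A)]

theorem convAssociator_naturality {F F' G G' K K' : X.simplices 1 ⥤ V}
    (α : F ⟶ F') (β : G ⟶ G') (γ : K ⟶ K') :
    convMap (convMap α β) γ ≫ (convAssociator F' G' K').hom =
      (convAssociator F G K).hom ≫ convMap α (convMap β γ) := by
  refine conv_conv_hom_ext fun s => ?_
  have h₂ := convMulAt_convAssociator F' G' K' s 0 1 2 3 (by decide) (by decide) (by decide)
  have e₁ := convMulAt_convMap α β s 0 1 2 (by decide) (by decide)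
  have e₂ := convMulAt_convMap β γ s 1 2 3 (by decide) (by decide)
  rw [NatTrans.comp_app, NatTrans.comp_app, convMulAt_convMap_assoc, convMulAt_convAssociator_assoc,
    convMulAt_convMap, ← tensorHom_id, ← id_tensorHom]
  rw [MonoidalCategory.tensorHom_comp_tensorHom_assoc,
    MonoidalCategory.tensorHom_comp_tensorHom_assoc, e₁, e₂, Category.id_comp, Category.id_comp]
  rw [← Category.comp_id (γ.app _), ← MonoidalCategory.tensorHom_comp_tensorHom_assoc,
    tensorHom_id, h₂, ← Category.comp_id (α.app _), ← MonoidalCategory.tensorHom_comp_tensorHom,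
    id_tensorHom, MonoidalCategory.associator_naturality_assoc]
  simp

/-- On the universal maps from `X_4`, the five associators act through the five tetrahedra of a
`4`-simplex, so that the pentagon identity becomes that of `V`. -/
theorem conv_pentagon (F G K M : X.simplices 1 ⥤ V) :
    convMap (convAssociator F G K).hom (𝟙 M) ≫ (convAssociator F (conv G K) M).hom ≫
        convMap (𝟙 F) (convAssociator G K M).hom =
      (convAssociator (conv F G) K M).hom ≫ (convAssociator F G (conv K M)).hom := by
  refine conv_conv_conv_hom_ext fun s => ?_
  have h₁ := convMulAt_convAssociator F G K s 0 1 2 3 (by decide) (by decide) (by decide)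
  have h₂ := convMulAt_convAssociator F (conv G K) M s 0 1 3 4
    (by decide) (by decide) (by decide)
  have h₃ := convMulAt_convAssociator G K M s 1 2 3 4 (by decide) (by decide) (by decide)
  have h₄ := convMulAt_convAssociator (conv F G) K M s 0 2 3 4
    (by decide) (by decide) (by decide)
  have h₅ := convMulAt_convAssociator F G (conv K M) s 0 1 2 4
    (by decide) (by decide) (by decide)
  simp only [NatTrans.comp_app]
  rw [convMulAt_convMap_assoc, NatTrans.id_app, tensorHom_id, ← comp_whiskerRight_assoc,
    Category.assoc, h₁, comp_whiskerRight, comp_whiskerRight, Category.assoc, Category.assoc,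
    reassoc_of% h₂, convMulAt_convMap, NatTrans.id_app, id_tensorHom,
    ← MonoidalCategory.whiskerLeft_comp_assoc, associator_naturality_middle_assoc,
    ← MonoidalCategory.whiskerLeft_comp_assoc, h₃]
  rw [comp_whiskerRight, Category.assoc, reassoc_of% h₄, associator_naturality_left_assoc,
    ← whisker_exchange_assoc, h₅]
  simp

/-- On the universal maps from `X_2`, the associator acts through the degenerate tetrahedron `0112`
of a triangle, so that the triangle identity becomes that of `V`. -/
theorem conv_triangle (F G : X.simplices 1 ⥤ V) :
    (convAssociator F (convUnit V X) G).hom ≫ convMap (𝟙 F) (convLeftUnitor G).hom =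
      convMap (convRightUnitor F).hom (𝟙 G) := by
  refine conv_convUnit_conv_hom_ext fun s => ?_
  have h₁ := convMulAt_convAssociator F (convUnit V X) G s 0 1 1 2
    (by decide) (by decide) (by decide)
  have h₂ := convMulAt_convLeftUnitor G s 1 2 (by decide)
  have h₃ := convMulAt_convRightUnitor F s 0 1 (by decide)
  rw [convMulAt_convMap, NatTrans.comp_app, NatTrans.id_app, tensorHom_id,
    ← comp_whiskerRight_assoc, Category.assoc, h₃, comp_whiskerRight, Category.assoc,
    reassoc_of% h₁, convMulAt_convMap, NatTrans.id_app, id_tensorHom,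
    ← MonoidalCategory.whiskerLeft_comp_assoc, associator_naturality_middle_assoc,
    ← MonoidalCategory.whiskerLeft_comp_assoc, h₂, MonoidalCategory.triangle_assoc]

end Convolution

end SimplicialGroupoid

/-! ### The Hall monoidal category -/

namespace HallCat

section Monoidal

variable (V : Type u) [Category.{v} V] [MonoidalCategory V] [Limits.HasColimitsOfSize.{w, w} V]
  [∀ A : V, Limits.PreservesColimitsOfSize.{w, w} (tensorLeft A)]
  [∀ A : V, Limits.PreservesColimitsOfSize.{w, w} (tensorRight A)]
  (X : SimplicialGroupoid.{w}) [Fact X.IsTwoSegal]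

open SimplicialGroupoid

/-- The functor category `[X_1, V]` with the convolution product. -/
noncomputable abbrev hallMonoidalCategoryStruct : MonoidalCategoryStruct (HallCat V X) where
  tensorObj F G := conv (und.obj F) (und.obj G)
  tensorUnit := convUnit V X
  tensorHom α β := convMap (und.map α) (und.map β)
  whiskerLeft F _ _ β := convMap (𝟙 (und.obj F)) (und.map β)
  whiskerRight α G := convMap (und.map α) (𝟙 (und.obj G))
  associator F G K := convAssociator (und.obj F) (und.obj G) (und.obj K)
  leftUnitor F := convLeftUnitor (und.obj F)
  rightUnitor F := convRightUnitor (und.obj F)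

/-- The Hall monoidal structure on the functor category `[X_1, V]`. -/
noncomputable abbrev hallMonoidalCategory : MonoidalCategory (HallCat V X) :=
  letI := hallMonoidalCategoryStruct V X
  MonoidalCategory.ofTensorHom
    (id_tensorHom_id := fun F G => convMap_id (und.obj F) (und.obj G))
    (id_tensorHom := fun _ _ _ _ => rfl)
    (tensorHom_id := fun _ _ => rfl)
    (tensorHom_comp_tensorHom := fun α β α' β' =>
      (convMap_comp (und.map α) (und.map β) (und.map α') (und.map β')).symm)
    (associator_naturality := fun α β γ =>
      convAssociator_naturality (und.map α) (und.map β) (und.map γ))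
    (leftUnitor_naturality := fun α => convLeftUnitor_naturality (und.map α))
    (rightUnitor_naturality := fun α => convRightUnitor_naturality (und.map α))
    (pentagon := fun F G K M =>
      conv_pentagon (und.obj F) (und.obj G) (und.obj K) (und.obj M))
    (triangle := fun F G => conv_triangle (und.obj F) (und.obj G))

/-- The universal transformations of the convolution product. -/
noncomputable def hallConvolutionData :
    letI := hallMonoidalCategory V X
    HallConvolutionData V X :=
  letI := hallMonoidalCategory V X
  { mul := fun F G => convMul (und.obj F) (und.obj G)
    mul_isLeftKanExtension := fun F G =>
      inferInstanceAs ((conv (und.obj F) (und.obj G)).IsLeftKanExtension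
        (convMul (und.obj F) (und.obj G)))
    one := convOne V X
    one_isLeftKanExtension := inferInstanceAs ((convUnit V X).IsLeftKanExtension (convOne V X)) }

/-- The Hall monoidal structure is the one induced from `V`. -/
noncomputable def hallConvolution :
    letI := hallMonoidalCategory V X
    HallConvolution V X :=
  letI := hallMonoidalCategory V X
  { toHallConvolutionData := hallConvolutionData V X
    mul_natural := fun α β t => (convMulApp_convMap (und.map α) (und.map β) t).symm
    associator := fun F G K s => convAssociator_hom_app (und.obj F) (und.obj G) (und.obj K) s
    leftUnitor := fun F x => convLeftUnitor_hom_app (und.obj F) x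
    rightUnitor := fun F x => convRightUnitor_hom_app (und.obj F) x }

end Monoidal

end HallCat

/-! ### The lax monoidal structure on restriction -/

namespace SimplicialGroupoid

section Restriction

variable {V : Type u} [Category.{v} V] [MonoidalCategory V] [Limits.HasColimitsOfSize.{w, w} V]
  {X Y Z : SimplicialGroupoid.{w}} (f : X ⟶ Y)

theorem map_pull_mapSimplices {m n : ℕ} (φ : ⦋m⦌ ⟶ ⦋n⦌) {s s' : X.simplices n} (a : s ⟶ s') :
    (Y.pull φ).map ((mapSimplices f n).map a) =
      eqToHom (pull_mapSimplices f φ s) ≫ (mapSimplices f m).map ((X.pull φ).map a) ≫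
        eqToHom (pull_mapSimplices f φ s').symm :=
  Functor.congr_hom (f.naturality φ.op).symm a

/-- The comparison map `f^* F ⊗ f^* G ⟶ f^* (F ⊗ G)`, induced by the universal maps at the triangles
`f_2 t` of `Y`. -/
noncomputable def convRestrict (F G : Y.simplices 1 ⥤ V) :
    conv (mapSimplices f 1 ⋙ F) (mapSimplices f 1 ⋙ G) ⟶ mapSimplices f 1 ⋙ conv F G :=
  Functor.descOfIsLeftKanExtension _ (convMul _ _) _
    { app := fun t => convMulAux F G ((mapSimplices f 2).obj t)
        (pull_mapSimplices f _ t) (pull_mapSimplices f _ t) (pull_mapSimplices f _ t)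
      naturality := fun _ _ a => convMulAux_naturality F G ((mapSimplices f 2).map a) _ _ _
        (map_pull_mapSimplices f _ a) (map_pull_mapSimplices f _ a) (map_pull_mapSimplices f _ a) }

variable (V) in
/-- The comparison map `𝟙 ⟶ f^* 𝟙`, induced by the universal maps at the vertices `f_0 p` of `Y`. -/
noncomputable def convUnitRestrict : convUnit V X ⟶ mapSimplices f 1 ⋙ convUnit V Y :=
  Functor.descOfIsLeftKanExtension _ (convOne V X) _
    { app := fun p => convOneAux ((mapSimplices f 0).obj p) (pull_mapSimplices f _ p)
      naturality := fun _ _ a => (Category.id_comp _).trans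
        (convOneAux_naturality ((mapSimplices f 0).map a) _ (map_pull_mapSimplices f _ a)) }

theorem convMulApp_convRestrict (F G : Y.simplices 1 ⥤ V) (t : X.simplices 2) :
    convMulApp (mapSimplices f 1 ⋙ F) (mapSimplices f 1 ⋙ G) t ≫
        (convRestrict f F G).app ((X.edge 0 2).obj t) =
      convMulAux F G ((mapSimplices f 2).obj t)
        (pull_mapSimplices f _ t) (pull_mapSimplices f _ t) (pull_mapSimplices f _ t) :=
  Functor.descOfIsLeftKanExtension_fac_app _ (convMul _ _) _ _ t

theorem convOneApp_convUnitRestrict (p : X.simplices 0) :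
    convOneApp V p ≫ (convUnitRestrict V f).app ((X.edge 0 0).obj p) =
      convOneAux ((mapSimplices f 0).obj p) (pull_mapSimplices f _ p) :=
  Functor.descOfIsLeftKanExtension_fac_app _ (convOne V X) _ _ p

theorem convMulAux_convRestrict (F G : Y.simplices 1 ⥤ V) (t : X.simplices 2)
    {x y z : X.simplices 1}
    (hx : (X.edge 0 1).obj t = x) (hy : (X.edge 1 2).obj t = y) (hz : (X.edge 0 2).obj t = z) :
    convMulAux (mapSimplices f 1 ⋙ F) (mapSimplices f 1 ⋙ G) t hx hy hz ≫
        (convRestrict f F G).app z =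
      convMulAux F G ((mapSimplices f 2).obj t)
        ((pull_mapSimplices f _ t).trans (congrArg _ hx))
        ((pull_mapSimplices f _ t).trans (congrArg _ hy))
        ((pull_mapSimplices f _ t).trans (congrArg _ hz)) := by
  subst hx hy hz
  refine Eq.trans ?_ (convMulApp_convRestrict f F G t)
  simp [convMulAux]

theorem convOneAux_convUnitRestrict (p : X.simplices 0) {x : X.simplices 1}
    (hx : (X.edge 0 0).obj p = x) :
    convOneAux p hx ≫ (convUnitRestrict V f).app x =
      convOneAux ((mapSimplices f 0).obj p)
        ((pull_mapSimplices f _ p).trans (congrArg _ hx)) := by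
  subst hx
  refine Eq.trans ?_ (convOneApp_convUnitRestrict f p)
  simp [convOneAux]

theorem convMulAt_convRestrict (F G : Y.simplices 1 ⥤ V) {n : ℕ} (s : X.simplices n)
    (i j k : Fin (n + 1)) (hij : i ≤ j) (hjk : j ≤ k) :
    convMulAt (mapSimplices f 1 ⋙ F) (mapSimplices f 1 ⋙ G) s i j k hij hjk ≫
        (convRestrict f F G).app ((X.edge i k (hij.trans hjk)).obj s) =
      convMulAux F G ((mapSimplices f 2).obj ((X.triangle i j k hij hjk).obj s))
        ((pull_mapSimplices f _ _).trans (congrArg _ (edge01_triangle i j k hij hjk s)))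
        ((pull_mapSimplices f _ _).trans (congrArg _ (edge12_triangle i j k hij hjk s)))
        ((pull_mapSimplices f _ _).trans (congrArg _ (edge02_triangle i j k hij hjk s))) :=
  convMulAux_convRestrict ..

theorem convMulAt_convRestrict_assoc (F G : Y.simplices 1 ⥤ V) {n : ℕ} (s : X.simplices n)
    (i j k : Fin (n + 1)) (hij : i ≤ j) (hjk : j ≤ k) {W : V}
    (h : (mapSimplices f 1 ⋙ conv F G).obj ((X.edge i k (hij.trans hjk)).obj s) ⟶ W) :
    convMulAt (mapSimplices f 1 ⋙ F) (mapSimplices f 1 ⋙ G) s i j k hij hjk ≫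
        (convRestrict f F G).app ((X.edge i k (hij.trans hjk)).obj s) ≫ h =
      convMulAux F G ((mapSimplices f 2).obj ((X.triangle i j k hij hjk).obj s))
        ((pull_mapSimplices f _ _).trans (congrArg _ (edge01_triangle i j k hij hjk s)))
        ((pull_mapSimplices f _ _).trans (congrArg _ (edge12_triangle i j k hij hjk s)))
        ((pull_mapSimplices f _ _).trans (congrArg _ (edge02_triangle i j k hij hjk s))) ≫ h := by
  rw [← Category.assoc, convMulAt_convRestrict]

theorem convOneAt_convUnitRestrict {n : ℕ} (s : X.simplices n) (i : Fin (n + 1)) :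
    convOneAt s i ≫ (convUnitRestrict V f).app ((X.edge i i le_rfl).obj s) =
      convOneAux ((mapSimplices f 0).obj ((X.vertex i).obj s))
        ((pull_mapSimplices f _ _).trans (congrArg _ (edge_vertex i s))) :=
  convOneAux_convUnitRestrict ..

theorem convRestrict_naturality {F F' G G' : Y.simplices 1 ⥤ V} (α : F ⟶ F') (β : G ⟶ G') :
    convMap (Functor.whiskerLeft (mapSimplices f 1) α) (Functor.whiskerLeft (mapSimplices f 1) β) ≫
        convRestrict f F' G' =
      convRestrict f F G ≫ Functor.whiskerLeft (mapSimplices f 1) (convMap α β) := by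
  refine conv_hom_ext fun t => ?_
  rw [NatTrans.comp_app, NatTrans.comp_app, reassoc_of% convMulApp_convMap,
    convMulApp_convRestrict, reassoc_of% convMulApp_convRestrict f F G t]
  exact (convMulAux_convMap α β _ _ _ _).symm

theorem convRestrict_id (F G : X.simplices 1 ⥤ V) : convRestrict (𝟙 X) F G = 𝟙 (conv F G) := by
  refine conv_hom_ext fun t => (convMulApp_convRestrict (𝟙 X) F G t).trans ?_
  refine Eq.trans (b := convMulApp F G t) ?_ (Category.comp_id _).symm
  -- Everything is strict for `𝟙 X`: the equalities of edges hold by definition.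
  change convMulAux F G t rfl rfl rfl = _
  simp [convMulAux]

theorem convUnitRestrict_id : convUnitRestrict V (𝟙 X) = 𝟙 (convUnit V X) := by
  refine convUnit_hom_ext fun p => (convOneApp_convUnitRestrict (𝟙 X) p).trans ?_
  refine Eq.trans (b := convOneApp V p) ?_ (Category.comp_id _).symm
  change convOneAux p rfl = _
  simp [convOneAux]

theorem convRestrict_comp (g : Y ⟶ Z) (F G : Z.simplices 1 ⥤ V) :
    convRestrict (f ≫ g) F G =
      convRestrict f (mapSimplices g 1 ⋙ F) (mapSimplices g 1 ⋙ G) ≫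
        Functor.whiskerLeft (mapSimplices f 1) (convRestrict g F G) := by
  refine conv_hom_ext fun t => (convMulApp_convRestrict (f ≫ g) F G t).trans ?_
  have h := congrArg (· ≫ (convRestrict g F G).app ((mapSimplices f 1).obj ((X.edge 0 2).obj t)))
    (convMulApp_convRestrict f (mapSimplices g 1 ⋙ F) (mapSimplices g 1 ⋙ G) t)
  exact (convMulAux_convRestrict g F G _ _ _ _).symm.trans (h.symm.trans (Category.assoc _ _ _))

theorem convUnitRestrict_comp (g : Y ⟶ Z) :
    convUnitRestrict V (f ≫ g) =
      convUnitRestrict V f ≫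
        Functor.whiskerLeft (mapSimplices f 1) (convUnitRestrict V g) := by
  refine convUnit_hom_ext fun p => (convOneApp_convUnitRestrict (f ≫ g) p).trans ?_
  have h := congrArg (· ≫ (convUnitRestrict V g).app
    ((mapSimplices f 1).obj ((X.edge 0 0).obj p))) (convOneApp_convUnitRestrict f p)
  exact (convOneAux_convUnitRestrict g _ _).symm.trans (h.symm.trans (Category.assoc _ _ _))

variable [Fact X.IsTwoSegal] [Fact Y.IsTwoSegal]

section

variable [∀ A : V, Limits.PreservesColimitsOfSize.{w, w} (tensorRight A)]

theorem convRestrict_leftUnitality (F : Y.simplices 1 ⥤ V) :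
    (convLeftUnitor (mapSimplices f 1 ⋙ F)).hom =
      convMap (convUnitRestrict V f) (𝟙 (mapSimplices f 1 ⋙ F)) ≫ convRestrict f (convUnit V Y) F ≫
        Functor.whiskerLeft (mapSimplices f 1) (convLeftUnitor F).hom := by
  refine convUnit_conv_hom_ext fun x => (convLeftUnitor_hom_app _ x).trans ?_
  rw [NatTrans.comp_app, NatTrans.comp_app, convMulAt_convMap_assoc, NatTrans.id_app,
    tensorHom_id, ← comp_whiskerRight_assoc, convOneAt_convUnitRestrict,
    convMulAt_convRestrict_assoc]
  exact (convMulAux_convLeftUnitor F ((mapSimplices f 1).obj ((X.edge 0 1).obj x))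
    ((pull_mapSimplices f _ _).trans (congrArg _ (triangle001_edge ..)))
    ((pull_mapSimplices f _ _).trans (congrArg _ (vertex0_edge ..))) ..).symm

end

section

variable [∀ A : V, Limits.PreservesColimitsOfSize.{w, w} (tensorLeft A)]

theorem convRestrict_rightUnitality (F : Y.simplices 1 ⥤ V) :
    (convRightUnitor (mapSimplices f 1 ⋙ F)).hom =
      convMap (𝟙 (mapSimplices f 1 ⋙ F)) (convUnitRestrict V f) ≫ convRestrict f F (convUnit V Y) ≫
        Functor.whiskerLeft (mapSimplices f 1) (convRightUnitor F).hom := by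
  refine conv_convUnit_hom_ext fun x => (convRightUnitor_hom_app _ x).trans ?_
  rw [NatTrans.comp_app, NatTrans.comp_app, convMulAt_convMap_assoc, NatTrans.id_app,
    id_tensorHom, ← MonoidalCategory.whiskerLeft_comp_assoc, convOneAt_convUnitRestrict,
    convMulAt_convRestrict_assoc]
  exact (convMulAux_convRightUnitor F ((mapSimplices f 1).obj ((X.edge 0 1).obj x))
    ((pull_mapSimplices f _ _).trans (congrArg _ (triangle011_edge ..)))
    ((pull_mapSimplices f _ _).trans (congrArg _ (vertex1_edge ..))) ..).symm

end

/-- On the universal maps from `X_3`, this is the characterization of the associator of `Y` at the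
tetrahedron `f_3 s`. -/
theorem convRestrict_associativity
    [∀ A : V, Limits.PreservesColimitsOfSize.{w, w} (tensorLeft A)]
    [∀ A : V, Limits.PreservesColimitsOfSize.{w, w} (tensorRight A)]
    (F G K : Y.simplices 1 ⥤ V) :
    convMap (convRestrict f F G) (𝟙 (mapSimplices f 1 ⋙ K)) ≫ convRestrict f (conv F G) K ≫
        Functor.whiskerLeft (mapSimplices f 1) (convAssociator F G K).hom =
      (convAssociator (mapSimplices f 1 ⋙ F) (mapSimplices f 1 ⋙ G) (mapSimplices f 1 ⋙ K)).hom ≫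
        convMap (𝟙 (mapSimplices f 1 ⋙ F)) (convRestrict f G K) ≫
          convRestrict f F (conv G K) := by
  refine conv_conv_hom_ext fun s => ?_
  rw [NatTrans.comp_app, NatTrans.comp_app, NatTrans.comp_app, NatTrans.comp_app,
    convMulAt_convAssociator_assoc, convMulAt_convMap_assoc, convMulAt_convMap_assoc,
    NatTrans.id_app, NatTrans.id_app, tensorHom_id, id_tensorHom, ← comp_whiskerRight_assoc,
    ← MonoidalCategory.whiskerLeft_comp_assoc, convMulAt_convRestrict, convMulAt_convRestrict,
    convMulAt_convRestrict_assoc, convMulAt_convRestrict]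
  exact convMulAux_convAssociator F G K ((mapSimplices f 3).obj s) (pull_mapSimplices ..)
    (pull_mapSimplices ..) (pull_mapSimplices ..) (pull_mapSimplices ..) ..

end Restriction

end SimplicialGroupoid

/-! ### Functoriality -/

namespace HallCat

section Functoriality

variable (V : Type u) [Category.{v} V] [MonoidalCategory V] [Limits.HasColimitsOfSize.{w, w} V]
  [∀ A : V, Limits.PreservesColimitsOfSize.{w, w} (tensorLeft A)]
  [∀ A : V, Limits.PreservesColimitsOfSize.{w, w} (tensorRight A)]
  {X Y : SimplicialGroupoid.{w}} [Fact X.IsTwoSegal] [Fact Y.IsTwoSegal] (f : X ⟶ Y)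

open SimplicialGroupoid

/-- The lax monoidal structure on the restriction functor, for the Hall monoidal structures. -/
noncomputable abbrev restrictLaxMonoidal :
    letI := hallMonoidalCategory V X
    letI := hallMonoidalCategory V Y
    (restrict V f).LaxMonoidal :=
  letI := hallMonoidalCategory V X
  letI := hallMonoidalCategory V Y
  { ε := convUnitRestrict V f
    μ := fun F G => convRestrict f (und.obj F) (und.obj G)
    μ_natural_left := fun α G => convRestrict_naturality f (und.map α) (𝟙 (und.obj G))
    μ_natural_right := fun F β => convRestrict_naturality f (𝟙 (und.obj F)) (und.map β)
    associativity := fun F G K =>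
      convRestrict_associativity f (und.obj F) (und.obj G) (und.obj K)
    left_unitality := fun F => convRestrict_leftUnitality f (und.obj F)
    right_unitality := fun F => convRestrict_rightUnitality f (und.obj F) }

theorem isHallRestriction :
    letI := hallMonoidalCategory V X
    letI := hallMonoidalCategory V Y
    letI := restrictLaxMonoidal V f
    IsHallRestriction (hallConvolution V X) (hallConvolution V Y) f :=
  letI := hallMonoidalCategory V X
  letI := hallMonoidalCategory V Y
  letI := restrictLaxMonoidal V f
  { mul_comp_μ := fun F G t => by
      refine (convMulApp_convRestrict f (und.obj F) (und.obj G) t).trans ?_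
      rw [convMulAux]
      rfl
    one_comp_ε := fun z => by
      refine (convOneApp_convUnitRestrict f z).trans ?_
      rw [convOneAux]
      rfl }

instance (X : TwoSegalGroupoid.{w}) : Fact X.obj.IsTwoSegal := ⟨X.property⟩

/-- The functor sending a 2-Segal simplicial groupoid `X` to the Hall monoidal category
`[X_1, V]`, and a morphism to restriction along it. -/
noncomputable def hallFunctor : TwoSegalGroupoid.{w}ᵒᵖ ⥤ LaxMonCat.{max w v, max w v u} where
  obj X :=
    letI := hallMonoidalCategory V X.unop.obj
    LaxMonCat.of (HallCat V X.unop.obj)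
  map {X Y} f :=
    letI := hallMonoidalCategory V X.unop.obj
    letI := hallMonoidalCategory V Y.unop.obj
    letI := restrictLaxMonoidal V f.unop.hom
    LaxMonoidalFunctor.of (HallCat.restrict V f.unop.hom)
  -- The underlying functors agree by definition, so only the lax structures are compared.
  map_id X := by
    let := hallMonoidalCategory V X.unop.obj
    exact LaxMonCat.hom_ext (𝟭 (HallCat V X.unop.obj))
      (restrictLaxMonoidal V (𝟙 X.unop.obj)) Functor.LaxMonoidal.id convUnitRestrict_id
      (funext fun F => funext fun G => convRestrict_id (und.obj F) (und.obj G))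
  map_comp {X Y Z} f g := by
    let := hallMonoidalCategory V X.unop.obj
    let := hallMonoidalCategory V Y.unop.obj
    let := hallMonoidalCategory V Z.unop.obj
    let := restrictLaxMonoidal V f.unop.hom
    let := restrictLaxMonoidal V g.unop.hom
    exact LaxMonCat.hom_ext (HallCat.restrict V f.unop.hom ⋙ HallCat.restrict V g.unop.hom)
      (restrictLaxMonoidal V (g.unop.hom ≫ f.unop.hom)) (Functor.LaxMonoidal.comp _ _)
      (convUnitRestrict_comp g.unop.hom f.unop.hom)
      (funext fun F => funext fun G =>
        convRestrict_comp g.unop.hom f.unop.hom (und.obj F) (und.obj G))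

end Functoriality

end HallCat

theorem mainTheorem1 (V : Type u) [Category.{v} V] [MonoidalCategory V]
    [Limits.HasColimitsOfSize.{w, w} V]
    [∀ A : V, Limits.PreservesColimitsOfSize.{w, w} (tensorLeft A)]
    [∀ A : V, Limits.PreservesColimitsOfSize.{w, w} (tensorRight A)] :
    ∃ (_ : ∀ X : TwoSegalGroupoid.{w}, MonoidalCategory (HallCat V X.obj))
      (S : ∀ X : TwoSegalGroupoid.{w}, HallConvolution V X.obj)
      (_ : ∀ {X Y : TwoSegalGroupoid.{w}} (f : X ⟶ Y),
        (HallCat.restrict V f.hom).LaxMonoidal)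
      (Hall : TwoSegalGroupoid.{w}ᵒᵖ ⥤ LaxMonCat.{max w v, max w v u}),
      (∀ {X Y : TwoSegalGroupoid.{w}} (f : X ⟶ Y), IsHallRestriction (S X) (S Y) f.hom) ∧
      Hall.toPrefunctor =
        { obj := fun X => LaxMonCat.of (HallCat V X.unop.obj)
          map := fun f => LaxMonoidalFunctor.of (HallCat.restrict V f.unop.hom) } :=
  ⟨fun X => HallCat.hallMonoidalCategory V X.obj, fun X => HallCat.hallConvolution V X.obj,
    fun f => HallCat.restrictLaxMonoidal V f.hom, HallCat.hallFunctor V,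
    fun f => HallCat.isHallRestriction V f.hom, rfl⟩
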